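/- Notation. Write $S^2\subset\mathbb R^3$ for the unit sphere, $\bar{\mathbf x}=\mathbf x/|\mathbf x|$ for $\mathbf x\neq 0$, and $\theta\in[0,\pi]$ for the polar angle on $S^2$, $x_3=\cos\theta$. Say that $\omega:S^2\to\mathbb R$ satisfies (hx) if $\omega$ is smooth, $\min\omega=0$, $\omega(-\bar{\mathbf x})=\omega(\bar{\mathbf x})$ for all $\bar{\mathbf x}\in S^2$, and $\omega$ is axisymmetric with respect to the $x_3$-axis (so that $\omega=\omega(\theta)$). For $0<s<3$, the angle function $\tilde\omega$ of the Fourier transform is the (unique) continuous function $\tilde\omega:S^2\to\mathbb R$ such that $\mathcal F\big[|\mathbf x|^{-s}\omega(\bar{\mathbf x})\big]=|\xi|^{-3+s}\,\tilde\omega(\bar\xi)$ as tempered distributions on $\mathbb R^3$, where $\mathcal F\phi(\xi)=\int_{\mathbb R^3}\phi(\mathbf x)e^{-2\pi i\mathbf x\cdot\xi}\,d\mathbf x$. A function is sign-changing if it takes both positive and negative values. Theorem. Assume $1<s<2$ and fix $\theta_0\in(0,\pi/2)$. 1. There exists $\omega_1$ satisfying (hx), achieving its minimal value $\omega_1(\theta)=0$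 on $\theta\in[0,\pi/2-\theta_0]$, such that $\tilde\omega_1$ is strictly positive on $S^2$. 2. There exists $\omega_2$ satisfying (hx), achieving its minimal value $\omega_2(\theta)=0$ on $\theta\in[0,\pi/2-\theta_0]$, such that $\tilde\omega_2$ is sign-changing. If $s=1$ and $\theta_0\in(0,\pi/2)$, then the same holds with "strictly positive" in item 1 replaced by "nonnegative", where moreover $\omega_1$ is not identically zero. For $s=1$ item 1 is false without this replacement: for every $\theta_0\in(0,\pi/2)$ there is no $\omega$ satisfying (hx), vanishing on $\theta\in[0,\pi/2-\theta_0]$, with $\tilde\omega$ strictly positive on $S^2$. -/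

import Mathlib

open MeasureTheory Metric
open scoped Manifold FourierTransform SchwartzMap

/-- Three-dimensional Euclidean space. -/
abbrev E3 : Type := EuclideanSpace ℝ (Fin 3)

/-- The unit sphere `S²` of three-dimensional Euclidean space. -/
abbrev S2 : Type := sphere (0 : E3) 1

/-- The polar angle `θ ∈ [0, π]` of a point of the sphere: `x₃ = cos θ`. -/
noncomputable def polarAngle (x : S2) : ℝ := Real.arccos ((x : E3) 2)

/-- The direction `x / |x|` of a nonzero vector. -/
noncomputable def direction (x : E3) (hx : x ≠ 0) : S2 :=
  ⟨‖x‖⁻¹ • x, by simp [norm_smul, hx]⟩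

/-- The function `x ↦ |x|^p Ω(x / |x|)` on `ℝ³ \ {0}`, given the (irrelevant) value `0` at `0`. -/
noncomputable def homogeneousExt (p : ℝ) (Ω : S2 → ℝ) (x : E3) : ℝ :=
  open Classical in
  if hx : x = 0 then 0 else ‖x‖ ^ p * Ω (direction x hx)

/-- Admissible angular profiles: smooth on `S²`, of minimum value zero, even, and axisymmetric with
respect to the `x₃`-axis. The orbits of the rotations about that axis on `S²` are the level sets of
the third coordinate. -/
structure IsAxisymmetricProfile (ω : S2 → ℝ) : Prop where
  smooth : ContMDiff (𝓡 2) 𝓘(ℝ, ℝ) ((⊤ : ℕ∞) : WithTop ℕ∞) ω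
  min_eq_zero : IsLeast (Set.range ω) 0
  even : ∀ x : S2, ω (-x) = ω x
  axisymmetric : ∀ x y : S2, (x : E3) 2 = (y : E3) 2 → ω x = ω y

/-- `Ωt` is the angle function of the Fourier transform of `|x|^(-s) Ω(x / |x|)`: it is continuous on
`S²` (so it is determined at every point), and
`𝓕[|x|^(-s) Ω(x / |x|)] = |ξ|^(-3+s) Ωt(ξ / |ξ|)` as tempered distributions, with the convention
`𝓕φ(ξ) = ∫ φ(x) exp(-2πi x·ξ) dx`. -/
structure IsFourierAngleFunction (s : ℝ) (Ω Ωt : S2 → ℝ) : Prop where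
  continuous : Continuous Ωt
  fourier : ∀ φ : 𝓢(E3, ℂ),
    ∫ x : E3, (homogeneousExt (-s) Ω x : ℂ) * (𝓕 φ) x
      = ∫ ξ : E3, (homogeneousExt (-3 + s) Ωt ξ : ℂ) * φ ξ

/-- The function takes both positive and negative values. -/
def SignChanging (f : S2 → ℝ) : Prop := (∃ ξ, 0 < f ξ) ∧ ∃ ξ, f ξ < 0

/-!
The theorem is proved by superposing planes through the origin. For `y` in the horizontal plane,
identified with `ℂ`, the density `‖z‖^(1 - s)` on the plane `{x₃ = ⟪z, y⟫}`, `z = (x₁, x₂)`, has a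
Fourier transform that is constant along the normal of that plane: for `1 < s < 2` it is
`C ‖ξ_h + ξ₃ y‖^(s - 3)` with `C > 0`, where `ξ_h = (ξ₁, ξ₂)`, and for `s = 1` it is a multiple of the
line measure on the normal. Averaging over `y` with a radial weight `p (‖y‖²)` that is smooth and supported in the
disc of radius `tan θ₀` gives the homogeneous function `‖z‖⁻ˢ ψ (x₃ / ‖z‖)`, where `ψ` is the Abel
transform of the weight (`integral_homogeneousExt_bandProfile_mul`). Its angular profile is smooth,
even, axisymmetric and vanishes on the prescribed cap, and it is nonnegative as soon as `ψ` is, even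
if the weight changes sign. Its Fourier transform is explicit:

* for `1 < s < 2` it is a Riesz potential of the weight (`isFourierAngleFunction_bandAngle`);
* for `s = 1` it is `ξ₃⁻² p (‖ξ_h‖² / ξ₃²)` (`isFourierAngleFunction_bandAngleOne`).

A nonnegative weight thus gives a transform that is positive for `s > 1` and nonnegative for `s = 1`.
For a sign-changing transform the weight is `p u - 2 p (4 u)` with `p` decreasing: its Abel transform
is `ψ t - ψ (2 t) ≥ 0`, while at the pole its Riesz potential is `1 - 2^(2 - s) < 0` times that of `p`.

For `s = 1`, an angle function bounded below by `c > 0` would give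
`∫ ‖(ξ_h, ε ξ₃)‖⁻² u(ξ) dξ = O(1)` as `ε → 0` for a bump function `u`, because the profile vanishes
near the axis; by Fatou's lemma the inverse square would be locally integrable in the plane
(`IsFourierAngleFunction.not_pos_of_vanishing`).
-/

section

open scoped ContDiff RealInnerProductSpace

/-! ### Cylindrical coordinates -/

/-- The identification of `ℂ × ℝ` with three-dimensional space: the horizontal coordinates
`x₁, x₂` form a complex number, and the vertical coordinate `x₃` is the real one. -/
noncomputable def cyl : (ℂ × ℝ) ≃L[ℝ] E3 :=
  LinearEquiv.toContinuousLinearEquiv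
    { toFun := fun q => !₂[q.1.re, q.1.im, q.2]
      invFun := fun x => (⟨x 0, x 1⟩, x 2)
      map_add' := fun q r => by ext i; fin_cases i <;> simp
      map_smul' := fun c q => by ext i; fin_cases i <;> simp
      left_inv := fun q => by simp
      right_inv := fun x => by ext i; fin_cases i <;> simp }

/-- The horizontal part `(x₁, x₂)` of a vector, as a complex number. -/
noncomputable def horiz : E3 →L[ℝ] ℂ :=
  (ContinuousLinearMap.fst ℝ ℂ ℝ).comp (cyl.symm : E3 →L[ℝ] ℂ × ℝ)

lemma cyl_apply (q : ℂ × ℝ) : cyl q = !₂[q.1.re, q.1.im, q.2] := rfl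

lemma horiz_apply (x : E3) : horiz x = ⟨x 0, x 1⟩ := rfl

@[simp] lemma cyl_apply_two (q : ℂ × ℝ) : cyl q 2 = q.2 := rfl

@[simp] lemma horiz_cyl (q : ℂ × ℝ) : horiz (cyl q) = q.1 := rfl

@[simp] lemma cyl_horiz (x : E3) : cyl (horiz x, x 2) = x := by
  ext i; fin_cases i <;> rfl

lemma norm_sq_eq (x : E3) : ‖x‖ ^ 2 = ‖horiz x‖ ^ 2 + x 2 ^ 2 := by
  rw [EuclideanSpace.norm_sq_eq, Fin.sum_univ_three, horiz_apply, Complex.sq_norm,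
    Complex.normSq_apply]
  simp only [Real.norm_eq_abs, sq_abs]
  ring

lemma norm_horiz_le (x : E3) : ‖horiz x‖ ≤ ‖x‖ :=
  le_of_sq_le_sq (by rw [norm_sq_eq]; nlinarith [sq_nonneg (x 2)]) (norm_nonneg _)

lemma abs_two_le (x : E3) : |x 2| ≤ ‖x‖ :=
  abs_le_of_sq_le_sq (by rw [norm_sq_eq]; linarith [sq_nonneg ‖horiz x‖]) (norm_nonneg _)

lemma norm_cyl_sq (q : ℂ × ℝ) : ‖cyl q‖ ^ 2 = ‖q.1‖ ^ 2 + q.2 ^ 2 := by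
  rw [norm_sq_eq, horiz_cyl, cyl_apply_two]

lemma measurePreserving_cyl : MeasurePreserving (fun q : ℂ × ℝ => cyl q) volume volume := by
  have h1 : MeasurePreserving (Prod.swap : ℂ × ℝ → ℝ × ℂ) volume volume :=
    Measure.measurePreserving_swap
  have h2 : MeasurePreserving (Prod.map id Complex.measurableEquivPi : ℝ × ℂ → ℝ × (Fin 2 → ℝ))
      volume volume :=
    (MeasurePreserving.id volume).prod Complex.volume_preserving_equiv_pi
  have h3 := (volume_preserving_piFinSuccAbove (fun _ : Fin 3 => ℝ) 2).symm
  have h4 := PiLp.volume_preserving_toLp (Fin 3)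
  convert! h4.comp (h3.comp (h2.comp h1)) using 1
  ext q i
  fin_cases i <;> rfl

lemma integral_eq_integral_cyl {F : Type*} [NormedAddCommGroup F] [NormedSpace ℝ F] (f : E3 → F) :
    ∫ x, f x = ∫ q : ℂ × ℝ, f (cyl q) :=
  (measurePreserving_cyl.integral_comp cyl.toHomeomorph.measurableEmbedding f).symm

lemma integrable_iff_integrable_cyl {F : Type*} [NormedAddCommGroup F] {f : E3 → F} :
    Integrable f ↔ Integrable fun q : ℂ × ℝ => f (cyl q) :=
  (measurePreserving_cyl.integrable_comp_emb cyl.toHomeomorph.measurableEmbedding).symm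

/-! ### Integrability of weakly singular functions -/

section Singular
variable {E : Type*} [NormedAddCommGroup E] [NormedSpace ℝ E] [FiniteDimensional ℝ E]
  [MeasurableSpace E] [BorelSpace E] [Nontrivial E] (μ : Measure E) [μ.IsAddHaarMeasure]

lemma integrableOn_closedBall_norm_rpow {b : ℝ} (hb : b < Module.finrank ℝ E) (r : ℝ) :
    IntegrableOn (fun x : E => ‖x‖ ^ (-b)) (closedBall 0 r) μ := by
  refine (integrableOn_ball_of_norm_le_rpow (r := r + 1) (C := 1) Module.finrank_pos hb ?_ ?_).mono_set
    (closedBall_subset_ball (by linarith))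
  · filter_upwards with x
    rw [Real.norm_of_nonneg (by positivity), one_mul]
  · exact Measurable.aestronglyMeasurable (by fun_prop)

/-- A bounded integrable function stays integrable after multiplication by a singularity `‖x‖⁻ᵇ`
weaker than the dimension. -/
lemma integrable_norm_rpow_mul {b : ℝ} (hb0 : 0 ≤ b) (hb : b < Module.finrank ℝ E)
    {g : E → ℝ} (hg : Integrable g μ) {C : ℝ} (hC : ∀ x, |g x| ≤ C) :
    Integrable (fun x => ‖x‖ ^ (-b) * g x) μ := by
  have h1 : Integrable (fun x => (closedBall (0 : E) 1).indicator (fun x => C * ‖x‖ ^ (-b)) x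
      + |g x|) μ := by
    refine Integrable.add ?_ hg.abs
    rw [integrable_indicator_iff measurableSet_closedBall]
    exact (integrableOn_closedBall_norm_rpow μ hb 1).const_mul C
  refine h1.mono' ?_ ?_
  · exact (Measurable.aestronglyMeasurable (by fun_prop)).mul hg.1
  · filter_upwards with x
    rw [norm_mul, Real.norm_of_nonneg (by positivity), Real.norm_eq_abs]
    by_cases hx : x ∈ closedBall (0 : E) 1
    · rw [Set.indicator_of_mem hx]
      nlinarith [hC x, abs_nonneg (g x), Real.rpow_nonneg (norm_nonneg x) (-b)]
    · rw [Set.indicator_of_notMem hx]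
      have : ‖x‖ ^ (-b) ≤ 1 := by
        apply Real.rpow_le_one_of_one_le_of_nonpos _ (by linarith)
        simp at hx; exact hx.le
      nlinarith [abs_nonneg (g x)]

end Singular

/-! ### Decay of Schwartz functions -/

lemma SchwartzMap.exists_decay (φ : 𝓢(E3, ℂ)) (k : ℕ) :
    ∃ C : ℝ, 0 ≤ C ∧ ∀ x, ‖φ x‖ ≤ C * ((1 + ‖x‖) ^ k)⁻¹ := by
  refine ⟨2 ^ k * (Finset.Iic (k, 0)).sup (fun m => SchwartzMap.seminorm ℂ m.1 m.2) φ, by positivity,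
    fun x => ?_⟩
  have := SchwartzMap.one_add_le_sup_seminorm_apply (𝕜 := ℂ) (m := (k, 0)) le_rfl le_rfl φ x
  rw [norm_iteratedFDeriv_zero] at this
  rw [← div_eq_mul_inv, le_div_iff₀ (by positivity), mul_comm]
  exact this

/-- Decay of a Schwartz function, separately in the horizontal and in the vertical directions. -/
lemma SchwartzMap.exists_decay_cyl (φ : 𝓢(E3, ℂ)) (k l : ℕ) :
    ∃ C : ℝ, 0 ≤ C ∧ ∀ q : ℂ × ℝ,
      ‖φ (cyl q)‖ ≤ C * (((1 + ‖q.1‖) ^ k)⁻¹ * ((1 + |q.2|) ^ l)⁻¹) := by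
  obtain ⟨C, hC0, hC⟩ := φ.exists_decay (k + l)
  refine ⟨C, hC0, fun q => (hC _).trans ?_⟩
  have h1 : ‖q.1‖ ≤ ‖cyl q‖ := by simpa using norm_horiz_le (cyl q)
  have h2 : |q.2| ≤ ‖cyl q‖ := by simpa using abs_two_le (cyl q)
  rw [← mul_inv]
  have : (1 + ‖q.1‖) ^ k * (1 + |q.2|) ^ l ≤ (1 + ‖cyl q‖) ^ (k + l) := by
    rw [pow_add]; gcongr
  gcongr

lemma integrable_inv_one_add_norm_pow {E : Type*} [NormedAddCommGroup E] [NormedSpace ℝ E]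
    [FiniteDimensional ℝ E] [MeasurableSpace E] [BorelSpace E] (μ : Measure E)
    [μ.IsAddHaarMeasure] {k : ℕ} (hk : Module.finrank ℝ E < k) :
    Integrable (fun x : E => ((1 + ‖x‖) ^ k)⁻¹) μ := by
  have := integrable_one_add_norm (μ := μ) (r := (k : ℝ)) (E := E) (by exact_mod_cast hk)
  refine this.congr (Filter.Eventually.of_forall fun x => ?_)
  simp only
  rw [Real.rpow_neg (by positivity), Real.rpow_natCast]

lemma inv_one_add_norm_pow_le_one {E : Type*} [NormedAddCommGroup E] (x : E) (k : ℕ) :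
    ((1 + ‖x‖) ^ k)⁻¹ ≤ 1 :=
  inv_le_one_of_one_le₀ (one_le_pow₀ (by linarith [norm_nonneg x]))

/-! ### Homogeneous functions -/

lemma continuousOn_homogeneousExt {Ω : S2 → ℝ} (hΩ : Continuous Ω) (p : ℝ) :
    ContinuousOn (homogeneousExt p Ω) {0}ᶜ := by
  rw [continuousOn_iff_continuous_domRestrict]
  have : ({0}ᶜ : Set E3).domRestrict (homogeneousExt p Ω)
      = fun x : ({0}ᶜ : Set E3) => ‖(x : E3)‖ ^ p * Ω (direction x x.2) := by
    ext x
    exact dif_neg x.2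
  rw [this]
  have hn : ∀ x : ({0}ᶜ : Set E3), ‖(x : E3)‖ ≠ 0 := fun x => norm_ne_zero_iff.2 x.2
  refine Continuous.mul ?_ (hΩ.comp ?_)
  · exact (continuous_norm.comp continuous_subtype_val).rpow_const fun x => Or.inl (hn x)
  · refine Continuous.subtype_mk ?_ _
    exact ((continuous_norm.comp continuous_subtype_val).inv₀ hn).smul continuous_subtype_val

lemma measurable_homogeneousExt {Ω : S2 → ℝ} (hΩ : Continuous Ω) (p : ℝ) :
    Measurable (homogeneousExt p Ω) :=
  measurable_of_continuousOn_compl_singleton 0 (continuousOn_homogeneousExt hΩ p)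

lemma homogeneousExt_of_ne {Ω : S2 → ℝ} {p : ℝ} {x : E3} (hx : x ≠ 0) :
    homogeneousExt p Ω x = ‖x‖ ^ p * Ω (direction x hx) := by
  simp [homogeneousExt, hx]

lemma exists_abs_homogeneousExt_le {Ω : S2 → ℝ} (hΩ : Continuous Ω) :
    ∃ M, 0 ≤ M ∧ ∀ p x, |homogeneousExt p Ω x| ≤ M * ‖x‖ ^ p := by
  obtain ⟨M, hM⟩ := (isCompact_range hΩ).isBounded.exists_norm_le
  have hM0 : 0 ≤ M := (norm_nonneg _).trans
    (hM (Ω ⟨EuclideanSpace.single 0 1, by simp⟩) (Set.mem_range_self _))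
  refine ⟨M, hM0, fun p x => ?_⟩
  by_cases hx : x = 0
  · simp only [homogeneousExt, hx, dite_true, abs_zero]
    positivity
  · rw [homogeneousExt_of_ne hx, abs_mul, abs_of_nonneg (by positivity), mul_comm]
    gcongr
    exact hM _ (Set.mem_range_self _)

lemma horiz_direction (x : E3) (hx : x ≠ 0) :
    horiz (direction x hx : E3) = ‖x‖⁻¹ • horiz x := by
  simp [direction]

lemma direction_two (x : E3) (hx : x ≠ 0) : (direction x hx : E3) 2 = ‖x‖⁻¹ * x 2 := by
  simp [direction]

/-- The pairing of a homogeneous function with a Schwartz function converges absolutely. -/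
lemma integrable_homogeneousExt_mul {Ω : S2 → ℝ} (hΩ : Continuous Ω) {b : ℝ} (hb0 : 0 ≤ b)
    (hb : b < 3) (φ : 𝓢(E3, ℂ)) :
    Integrable fun x : E3 => (homogeneousExt (-b) Ω x : ℂ) * φ x := by
  obtain ⟨M, hM0, hM⟩ := exists_abs_homogeneousExt_le hΩ
  obtain ⟨C, hC0, hC⟩ := φ.exists_decay 0
  have h3 : Module.finrank ℝ E3 = 3 := by simp
  have := (integrable_norm_rpow_mul volume hb0 (E := E3) (by rw [h3]; exact_mod_cast hb)
    φ.integrable.norm (C := C) (fun x => by simpa using hC x)).const_mul M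
  refine this.mono' ?_ ?_
  · exact ((measurable_homogeneousExt hΩ _).complex_ofReal.aestronglyMeasurable).mul
      φ.continuous.aestronglyMeasurable
  · filter_upwards with x
    rw [norm_mul, Complex.norm_real, Real.norm_eq_abs, ← mul_assoc]
    gcongr
    exact hM _ x

/-! ### Radial densities and their Abel transforms -/

/-- The Abel transform: `abel p t` is the integral of the radial planar density `y ↦ p (‖y‖²)` over
a line at distance `|t|` from the origin. -/
noncomputable def abel (p : ℝ → ℝ) (t : ℝ) : ℝ := ∫ v : ℝ, p (t ^ 2 + v ^ 2)

/-- Densities on the plane of the form `y ↦ p (‖y‖²)`, smooth and supported in the disc of radius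
`R`; the squared norm is used as the variable so that smoothness at the origin is automatic. -/
structure IsRadialDensity (R : ℝ) (p : ℝ → ℝ) : Prop where
  smooth : ContDiff ℝ ∞ p
  eq_zero : ∀ u, R ^ 2 ≤ u → p u = 0

lemma abel_neg (p : ℝ → ℝ) (t : ℝ) : abel p (-t) = abel p t := by simp [abel]

namespace IsRadialDensity

variable {R : ℝ} {p : ℝ → ℝ}

lemma abel_eq_zero (hp : IsRadialDensity R p) {t : ℝ} (ht : R ^ 2 ≤ t ^ 2) : abel p t = 0 := by
  simp only [abel]
  rw [integral_eq_zero_of_ae]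
  exact Filter.Eventually.of_forall fun v => hp.eq_zero _ (by nlinarith [sq_nonneg v])

lemma contDiff_abel (hp : IsRadialDensity R p) : ContDiff ℝ ∞ (abel p) := by
  have h := contDiffOn_convolution_right_with_param_comp (𝕜 := ℝ) (n := ⊤) (μ := (volume : Measure ℝ))
    (ContinuousLinearMap.mul ℝ ℝ) (s := (Set.univ : Set ℝ)) (v := fun _ : ℝ => (0 : ℝ))
    contDiffOn_const (f := fun _ : ℝ => (1 : ℝ)) (g := fun t v => p (t ^ 2 + v ^ 2))
    (k := Set.Icc (-|R|) |R|) isOpen_univ isCompact_Icc ?_ (locallyIntegrable_const 1) ?_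
  · rw [contDiffOn_univ] at h
    convert! h using 1
    ext t
    simp [convolution_def, abel]
  · intro t v _ hv
    apply hp.eq_zero
    have : |R| ≤ |v| := by
      by_contra! hlt
      exact hv (abs_le.1 hlt.le)
    nlinarith [sq_nonneg t, sq_le_sq.2 this]
  · apply ContDiff.contDiffOn
    exact hp.smooth.comp (by fun_prop : ContDiff ℝ ∞ fun q : ℝ × ℝ => q.1 ^ 2 + q.2 ^ 2)

lemma continuous_density (hp : IsRadialDensity R p) : Continuous fun y : ℂ => p (‖y‖ ^ 2) :=
  hp.smooth.continuous.comp (by fun_prop)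

lemma density_eq_zero (hp : IsRadialDensity R p) {y : ℂ} (hy : |R| ≤ ‖y‖) : p (‖y‖ ^ 2) = 0 :=
  hp.eq_zero _ (by rw [← sq_abs R]; gcongr)

lemma hasCompactSupport_density (hp : IsRadialDensity R p) :
    HasCompactSupport fun y : ℂ => p (‖y‖ ^ 2) :=
  HasCompactSupport.intro (isCompact_closedBall 0 |R|) fun y hy =>
    hp.density_eq_zero (by simp at hy; exact hy.le)

lemma integrable_density (hp : IsRadialDensity R p) : Integrable fun y : ℂ => p (‖y‖ ^ 2) :=
  hp.continuous_density.integrable_of_hasCompactSupport hp.hasCompactSupport_density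

lemma exists_bound (hp : IsRadialDensity R p) : ∃ M, 0 ≤ M ∧ ∀ y : ℂ, |p (‖y‖ ^ 2)| ≤ M := by
  obtain ⟨M, hM⟩ := hp.hasCompactSupport_density.exists_bound_of_continuous hp.continuous_density
  exact ⟨M, (norm_nonneg _).trans (hM 0), hM⟩

end IsRadialDensity

/-- The integral of a ridge function against a radial density reduces, in coordinates adapted to
the direction `x`, to a one-dimensional integral against the Abel transform. -/
lemma integral_density_mul_ridge {R : ℝ} {p : ℝ → ℝ} (hp : IsRadialDensity R p) {x : ℂ} (hx : x ≠ 0)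
    {f : ℝ → ℂ} (hf : Continuous f) :
    ∫ y : ℂ, (p (‖y‖ ^ 2) : ℂ) * f ⟪x, y⟫ =
      ((‖x‖⁻¹ : ℝ) : ℂ) * ∫ t : ℝ, (abel p (t / ‖x‖) : ℂ) * f t := by
  have hx' : ‖x‖ ≠ 0 := norm_ne_zero_iff.2 hx
  let u : Circle := ⟨x / ‖x‖, by simp [Submonoid.unitSphere, hx']⟩
  have hmp : MeasurePreserving (rotation u) (volume : Measure ℂ) volume :=
    (rotation u).measurePreserving
  have h1 : ∀ w : ℂ, ⟪x, rotation u w⟫ = ‖x‖ * w.re := by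
    intro w
    have hc : (starRingEnd ℂ) x * (rotation u w) = (‖x‖ : ℂ) * w := by
      have h0 : (‖x‖ : ℂ) ≠ 0 := by exact_mod_cast hx'
      rw [rotation_apply]
      change (starRingEnd ℂ) x * (x / ‖x‖ * w) = _
      have := Complex.conj_mul' x
      field_simp
      rw [this]
    rw [Complex.inner, mul_comm (rotation u w), hc, Complex.re_ofReal_mul]
  rw [← hmp.integral_comp (rotation u).toHomeomorph.measurableEmbedding]
  simp only [h1, LinearIsometryEquiv.norm_map]
  rw [← (Complex.volume_preserving_equiv_real_prod.symm).integral_comp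
    Complex.measurableEquivRealProd.symm.measurableEmbedding]
  have hnorm : ∀ q : ℝ × ℝ, ‖Complex.measurableEquivRealProd.symm q‖ ^ 2 = q.1 ^ 2 + q.2 ^ 2 := by
    intro q
    rw [Complex.measurableEquivRealProd_symm_apply, Complex.sq_norm, Complex.normSq_mk]
    ring
  have hint : Integrable (fun q : ℝ × ℝ => (p (q.1 ^ 2 + q.2 ^ 2) : ℂ) * f (‖x‖ * q.1))
      (volume.prod volume) := by
    have : Integrable fun y : ℂ => (p (‖y‖ ^ 2) : ℂ) * f (‖x‖ * y.re) := by
      apply Continuous.integrable_of_hasCompactSupport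
      · exact (Complex.continuous_ofReal.comp hp.continuous_density).mul
          (hf.comp (continuous_const.mul Complex.continuous_re))
      · exact (hp.hasCompactSupport_density.comp_left (g := fun r : ℝ => (r : ℂ)) (by simp)).mul_right
    have := Complex.volume_preserving_equiv_real_prod.symm.integrable_comp_of_integrable this
    refine this.congr (Filter.Eventually.of_forall fun q => ?_)
    simp only [Function.comp, hnorm]
    simp
  simp only [hnorm]
  change ∫ q : ℝ × ℝ, (p (q.1 ^ 2 + q.2 ^ 2) : ℂ) * f (‖x‖ * q.1) ∂(volume.prod volume) = _
  rw [integral_prod _ hint]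
  have h2 : ∀ r : ℝ, ∫ v : ℝ, (p (r ^ 2 + v ^ 2) : ℂ) * f (‖x‖ * r)
      = (abel p ((‖x‖ * r) / ‖x‖) : ℂ) * f (‖x‖ * r) := by
    intro r
    rw [integral_mul_const, mul_div_cancel_left₀ _ hx', abel]
    exact congrArg (· * f (‖x‖ * r)) integral_ofReal
  simp only [h2]
  rw [Measure.integral_comp_mul_left (fun t => (abel p (t / ‖x‖) : ℂ) * f t)]
  rw [abs_of_nonneg (by positivity), Complex.real_smul]

/-! ### The great-circle superposition -/

/-- The angular profile whose homogeneous extension of degree `-s` is the superposition, with weight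
`p (‖y‖²)`, of the densities `‖z‖^(1-s)` on the planes `x₃ = ⟪z, y⟫`, where `z` is the horizontal
part of `x`. The plane integral over `y` leaves only the Abel transform of `p`. -/
noncomputable def bandProfile (s : ℝ) (p : ℝ → ℝ) (σ : S2) : ℝ :=
  ‖horiz (σ : E3)‖ ^ (-s) * abel p ((σ : E3) 2 / ‖horiz (σ : E3)‖)

lemma homogeneousExt_bandProfile (s : ℝ) (p : ℝ → ℝ) {x : E3} (hx : x ≠ 0) :
    homogeneousExt (-s) (bandProfile s p) x
      = ‖horiz x‖ ^ (-s) * abel p (x 2 / ‖horiz x‖) := by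
  have hx' : 0 < ‖x‖ := norm_pos_iff.2 hx
  rw [homogeneousExt_of_ne hx, bandProfile, horiz_direction, direction_two, norm_smul, norm_inv,
    norm_norm, Real.mul_rpow (by positivity) (by positivity), Real.inv_rpow hx'.le, ← mul_assoc,
    ← mul_assoc, mul_inv_cancel₀ (by positivity), one_mul, mul_div_mul_left _ _ (by positivity)]

lemma sphere_norm_sq (σ : S2) : ‖horiz (σ : E3)‖ ^ 2 + (σ : E3) 2 ^ 2 = 1 := by
  rw [← norm_sq_eq]; simp

namespace IsRadialDensity

variable {R : ℝ} {p : ℝ → ℝ}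

lemma contMDiff_bandProfile (hp : IsRadialDensity R p) {s : ℝ} (hs : s ≠ 0) :
    ContMDiff (𝓡 2) 𝓘(ℝ, ℝ) ((⊤ : ℕ∞) : WithTop ℕ∞) (bandProfile s p) := by
  intro σ
  set f : E3 → ℝ := fun x => ‖horiz x‖ ^ (-s) * abel p (x 2 / ‖horiz x‖) with hf
  have : Fact (Module.finrank ℝ E3 = 2 + 1) := ⟨by simp⟩
  have hcoe : ContMDiff (𝓡 2) 𝓘(ℝ, E3) ((⊤ : ℕ∞) : WithTop ℕ∞) ((↑) : S2 → E3) :=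
    contMDiff_coe_sphere
  suffices h : ContDiffAt ℝ ∞ f (σ : E3) from
    ContMDiffAt.comp (g := f) σ h.contMDiffAt hcoe.contMDiffAt
  have h2 : ContDiff ℝ ∞ (fun x : E3 => x 2) := by fun_prop
  by_cases h0 : horiz (σ : E3) = 0
  · -- near a pole the Abel transform is evaluated outside its support
    have h3 : (σ : E3) 2 ^ 2 = 1 := by simpa [h0] using sphere_norm_sq σ
    have hev : ∀ᶠ x : E3 in nhds (σ : E3), R ^ 2 * ‖horiz x‖ ^ 2 < x 2 ^ 2 := by
      apply ContinuousAt.eventually_lt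
      · fun_prop
      · exact (h2.continuous.pow 2).continuousAt
      · simp [h0, h3]
    refine ContDiffAt.congr_of_eventuallyEq (contDiffAt_const (c := (0 : ℝ))) ?_
    filter_upwards [hev] with x hx
    simp only [hf]
    by_cases hz : ‖horiz x‖ = 0
    · rw [hz, Real.zero_rpow (neg_ne_zero.2 hs), zero_mul]
    · rw [hp.abel_eq_zero, mul_zero]
      rw [div_pow, le_div_iff₀ (by positivity)]
      exact hx.le
  · have hn : ContDiffAt ℝ ∞ (fun x : E3 => ‖horiz x‖) (σ : E3) :=
      (contDiffAt_norm ℝ h0).comp (σ : E3) horiz.contDiff.contDiffAt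
    have hn0 : ‖horiz (σ : E3)‖ ≠ 0 := norm_ne_zero_iff.2 h0
    exact (hn.rpow_const_of_ne hn0).mul
      (hp.contDiff_abel.contDiffAt.comp (σ : E3) (h2.contDiffAt.div hn hn0))

lemma continuous_bandProfile (hp : IsRadialDensity R p) {s : ℝ} (hs : s ≠ 0) :
    Continuous (bandProfile s p) :=
  (hp.contMDiff_bandProfile hs).continuous

/-- The profile vanishes where the slope `|x₃| / ‖(x₁, x₂)‖` is at least `R`. At the poles themselves
the value is `0 ^ (-s) = 0`. -/
lemma bandProfile_eq_zero (hp : IsRadialDensity R p) {s : ℝ} (hs : s ≠ 0) {σ : S2}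
    (hσ : R ^ 2 * ‖horiz (σ : E3)‖ ^ 2 ≤ (σ : E3) 2 ^ 2) : bandProfile s p σ = 0 := by
  rw [bandProfile]
  by_cases hz : ‖horiz (σ : E3)‖ = 0
  · rw [hz, Real.zero_rpow (neg_ne_zero.2 hs), zero_mul]
  · rw [hp.abel_eq_zero, mul_zero]
    rw [div_pow, le_div_iff₀ (by positivity)]
    exact hσ

lemma isAxisymmetricProfile_bandProfile (hp : IsRadialDensity R p) {s : ℝ} (hs : s ≠ 0)
    (hnn : ∀ t, 0 ≤ abel p t) : IsAxisymmetricProfile (bandProfile s p) where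
  smooth := hp.contMDiff_bandProfile hs
  min_eq_zero := by
    constructor
    · refine ⟨⟨EuclideanSpace.single 2 1, by simp⟩, hp.bandProfile_eq_zero hs ?_⟩
      have : horiz (EuclideanSpace.single 2 1 : E3) = 0 := by
        rw [horiz_apply]; apply Complex.ext <;> simp
      simp [this]
    · rintro _ ⟨σ, rfl⟩
      exact mul_nonneg (by positivity) (hnn _)
  even σ := by
    simp only [bandProfile]
    have h1 : ((-σ : S2) : E3) = -(σ : E3) := rfl
    rw [h1, map_neg, norm_neg, PiLp.neg_apply, neg_div, abel_neg]
  axisymmetric σ τ h := by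
    have : ‖horiz (σ : E3)‖ = ‖horiz (τ : E3)‖ := by
      rw [← sq_eq_sq₀ (norm_nonneg _) (norm_nonneg _)]
      have h1 := sphere_norm_sq σ
      have h2 := sphere_norm_sq τ
      rw [h] at h1
      linarith
    rw [bandProfile, bandProfile, this, h]

lemma bandProfile_eq_zero_of_polarAngle {θ₀ : ℝ} (h0 : 0 < θ₀) (h1 : θ₀ < Real.pi / 2)
    (hp : IsRadialDensity (Real.tan θ₀) p) {s : ℝ} (hs : s ≠ 0) {σ : S2}
    (hσ : polarAngle σ ≤ Real.pi / 2 - θ₀) : bandProfile s p σ = 0 := by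
  apply hp.bandProfile_eq_zero hs
  have hsin : 0 < Real.sin θ₀ := Real.sin_pos_of_pos_of_lt_pi h0 (by linarith)
  have hcos : 0 < Real.cos θ₀ := Real.cos_pos_of_mem_Ioo ⟨by linarith, h1⟩
  have hle : Real.sin θ₀ ≤ (σ : E3) 2 := by
    have habs : |(σ : E3) 2| ≤ 1 := by simpa using abs_two_le (σ : E3)
    rw [abs_le] at habs
    rw [← Real.cos_pi_div_two_sub, ← Real.cos_arccos habs.1 habs.2]
    exact Real.cos_le_cos_of_nonneg_of_le_pi (Real.arccos_nonneg _) (by linarith) hσ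
  rw [Real.tan_eq_sin_div_cos, div_pow, div_mul_eq_mul_div, div_le_iff₀ (by positivity)]
  have h2 := sphere_norm_sq σ
  have h3 := Real.sin_sq_add_cos_sq θ₀
  nlinarith [pow_le_pow_left₀ hsin.le hle 2]

end IsRadialDensity

lemma ae_ne_complex (z₀ : ℂ) : ∀ᵐ z : ℂ, z ≠ z₀ := by
  simp [ae_iff]

/-- The pairing with the homogeneous extension of a band profile, disintegrated over planes through
the origin. -/
lemma integral_homogeneousExt_bandProfile_mul {R : ℝ} {p : ℝ → ℝ} (hp : IsRadialDensity R p) {s : ℝ}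
    (hs1 : 1 ≤ s) (hs3 : s < 3) (g : 𝓢(E3, ℂ)) :
    ∫ x, (homogeneousExt (-s) (bandProfile s p) x : ℂ) * g x =
      ∫ y : ℂ, (p (‖y‖ ^ 2) : ℂ) *
        ∫ z : ℂ, ((‖z‖ ^ (-(s - 1)) : ℝ) : ℂ) * g (cyl (z, ⟪z, y⟫)) := by
  have hs0 : s ≠ 0 := by linarith
  have hint := integrable_homogeneousExt_mul (hp.continuous_bandProfile hs0) (by linarith) hs3 g
  rw [integrable_iff_integrable_cyl] at hint
  rw [integral_eq_integral_cyl, Measure.volume_eq_prod, integral_prod _ hint]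
  have h1 : ∀ z : ℂ, z ≠ 0 →
      ∫ t : ℝ, (homogeneousExt (-s) (bandProfile s p) (cyl (z, t)) : ℂ) * g (cyl (z, t)) =
        ∫ y : ℂ, (p (‖y‖ ^ 2) : ℂ) * (((‖z‖ ^ (-(s - 1)) : ℝ) : ℂ) * g (cyl (z, ⟪z, y⟫))) := by
    intro z hz
    have hz' : 0 < ‖z‖ := norm_pos_iff.2 hz
    have h2 : ∀ t : ℝ, (homogeneousExt (-s) (bandProfile s p) (cyl (z, t)) : ℂ) * g (cyl (z, t))
        = ((‖z‖ ^ (-s) : ℝ) : ℂ) * ((abel p (t / ‖z‖) : ℂ) * g (cyl (z, t))) := by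
      intro t
      have hne : cyl (z, t) ≠ 0 := fun h => hz (by simpa using congrArg horiz h)
      rw [homogeneousExt_bandProfile s p hne, horiz_cyl, cyl_apply_two]
      push_cast
      ring
    have h3 := integral_density_mul_ridge hp hz (f := fun t => g (cyl (z, t)))
      (g.continuous.comp (by fun_prop))
    simp only [h2, mul_left_comm (p _ : ℂ)]
    rw [integral_const_mul, integral_const_mul, h3, ← mul_assoc, ← Complex.ofReal_mul,
      ← Real.rpow_neg_one, ← Real.rpow_add hz']
    congr 4
    ring
  rw [integral_congr_ae ((ae_ne_complex 0).mono h1), integral_integral_swap]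
  · simp only [integral_const_mul]
  · obtain ⟨C, hC0, hC⟩ := g.exists_decay_cyl 3 0
    have hdom := ((integrable_norm_rpow_mul (E := ℂ) volume (b := s - 1) (by linarith)
      (by rw [Complex.finrank_real_complex]; push_cast; linarith)
      (integrable_inv_one_add_norm_pow volume (k := 3) (by rw [Complex.finrank_real_complex]; norm_num))
      (C := 1) (fun x => by
        rw [abs_of_nonneg (by positivity)]; exact inv_one_add_norm_pow_le_one x 3)).const_mul C).mul_prod
        hp.integrable_density.norm
    refine hdom.mono' ?_ ?_
    · have h1 : Measurable fun q : ℂ × ℂ => p (‖q.2‖ ^ 2) :=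
        (hp.continuous_density.comp continuous_snd).measurable
      have h2 : Measurable fun q : ℂ × ℂ => g (cyl (q.1, ⟪q.1, q.2⟫)) :=
        (g.continuous.comp (by fun_prop)).measurable
      have h3 : Measurable fun q : ℂ × ℂ => ‖q.1‖ ^ (-(s - 1)) := by fun_prop
      exact (h1.complex_ofReal.mul (h3.complex_ofReal.mul h2)).aestronglyMeasurable
    · filter_upwards with q
      have h := hC (q.1, ⟪q.1, q.2⟫)
      simp only [pow_zero, inv_one, mul_one] at h
      simp only [Function.uncurry, norm_mul, Complex.norm_real]
      rw [mul_comm]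
      have : ‖‖q.1‖ ^ (-(s - 1))‖ = ‖q.1‖ ^ (-(s - 1)) := Real.norm_of_nonneg (by positivity)
      rw [this, mul_left_comm C]
      gcongr

/-! ### Slices of the Fourier transform -/

/-- The linear map `(η, t) ↦ (η - t y, t)`: for fixed `η` it parametrizes the line through `(η, 0)`
that is orthogonal to the plane `{(z, ⟪z, y⟫)}`. -/
noncomputable def lineMap (y : ℂ) (q : ℂ × ℝ) : E3 := cyl (q.1 - q.2 • y, q.2)

/-- The adjoint of the embedding `z ↦ (z, ⟪z, y⟫)` of the plane. -/
noncomputable def planeProj (y : ℂ) (ξ : E3) : ℂ := horiz ξ + ξ 2 • y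

@[simp] lemma planeProj_lineMap (y : ℂ) (q : ℂ × ℝ) : planeProj y (lineMap y q) = q.1 := by
  simp [planeProj, lineMap]

lemma continuous_lineMap : Continuous fun a : ℂ × (ℂ × ℝ) => lineMap a.1 a.2 := by
  unfold lineMap; fun_prop

lemma continuous_planeProj : Continuous fun a : ℂ × E3 => planeProj a.1 a.2 := by
  unfold planeProj; fun_prop

lemma inner_cyl (ξ : E3) (z y : ℂ) : ⟪ξ, cyl (z, ⟪z, y⟫)⟫ = ⟪planeProj y ξ, z⟫ := by
  rw [PiLp.inner_apply, Fin.sum_univ_three, planeProj, horiz_apply, cyl_apply]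
  simp [Complex.inner]
  ring

lemma measurePreserving_lineMap (y : ℂ) : MeasurePreserving (lineMap y) volume volume := by
  have h1 : MeasurePreserving (fun a : ℝ × ℂ => (a.1, a.2 - a.1 • y)) (volume.prod volume)
      (volume.prod volume) := by
    refine (MeasurePreserving.id volume).skew_product (g := fun t η => η - t • y) ?_ ?_
    · exact Continuous.measurable (by fun_prop)
    · filter_upwards with t
      exact (measurePreserving_sub_right volume (t • y)).map_eq
  have h2 : MeasurePreserving (Prod.swap : ℂ × ℝ → ℝ × ℂ) volume (volume.prod volume) :=
    Measure.measurePreserving_swap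
  have h3 : MeasurePreserving (Prod.swap : ℝ × ℂ → ℂ × ℝ) (volume.prod volume) volume :=
    Measure.measurePreserving_swap
  exact measurePreserving_cyl.comp (h3.comp (h1.comp h2))

lemma measurableEmbedding_lineMap (y : ℂ) : MeasurableEmbedding (lineMap y) := by
  refine (cyl.toHomeomorph.trans (Homeomorph.refl _)).measurableEmbedding.comp
    (?_ : MeasurableEmbedding fun q : ℂ × ℝ => (q.1 - q.2 • y, q.2))
  exact (Homeomorph.mk (X := ℂ × ℝ) (Y := ℂ × ℝ)
    ⟨fun q => (q.1 - q.2 • y, q.2), fun q => (q.1 + q.2 • y, q.2), fun q => by simp,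
      fun q => by simp⟩ (by fun_prop) (by fun_prop)).measurableEmbedding

lemma integral_eq_integral_lineMap (y : ℂ) (f : E3 → ℂ) : ∫ ξ, f ξ = ∫ q, f (lineMap y q) :=
  ((measurePreserving_lineMap y).integral_comp (measurableEmbedding_lineMap y) f).symm

lemma integrable_comp_lineMap (φ : 𝓢(E3, ℂ)) (y : ℂ) : Integrable fun q => φ (lineMap y q) :=
  (measurePreserving_lineMap y).integrable_comp_of_integrable φ.integrable

/-- The integral of `φ` along the line through `(η, 0)` orthogonal to the plane `{(z, ⟪z, y⟫)}`. -/
noncomputable def lineIntegral (φ : 𝓢(E3, ℂ)) (y η : ℂ) : ℂ := ∫ t : ℝ, φ (lineMap y (η, t))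

lemma integrable_lineIntegral (φ : 𝓢(E3, ℂ)) (y : ℂ) : Integrable (lineIntegral φ y) := by
  have := integrable_comp_lineMap φ y
  rw [Measure.volume_eq_prod] at this
  exact this.integral_prod_left

lemma exists_decay_lineMap (φ : 𝓢(E3, ℂ)) (l : ℕ) :
    ∃ C : ℝ, 0 ≤ C ∧ ∀ y q, ‖φ (lineMap y q)‖ ≤ C * ((1 + ‖q.2‖) ^ l)⁻¹ := by
  obtain ⟨C, hC0, hC⟩ := φ.exists_decay_cyl 0 l
  exact ⟨C, hC0, fun y q => by simpa [lineMap] using hC (q.1 - q.2 • y, q.2)⟩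

lemma continuous_lineIntegral (φ : 𝓢(E3, ℂ)) (y : ℂ) : Continuous (lineIntegral φ y) := by
  obtain ⟨C, hC0, hC⟩ := exists_decay_lineMap φ 2
  refine continuous_of_dominated (bound := fun t => C * ((1 + ‖t‖) ^ 2)⁻¹) ?_ ?_ ?_ ?_
  · intro η
    exact (φ.continuous.comp (continuous_lineMap.comp (by fun_prop :
      Continuous fun t : ℝ => (y, (η, t))))).aestronglyMeasurable
  · intro η
    filter_upwards with t
    exact hC y (η, t)
  · exact (integrable_inv_one_add_norm_pow volume (by simp)).const_mul C
  · filter_upwards with t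
    exact φ.continuous.comp (continuous_lineMap.comp (by fun_prop :
      Continuous fun η : ℂ => (y, (η, t))))

/-- The restriction of the Fourier transform to a plane is the Fourier transform of the integrals
over the lines orthogonal to it. -/
lemma fourier_lineIntegral (φ : 𝓢(E3, ℂ)) (y z : ℂ) :
    𝓕 (lineIntegral φ y) z = (𝓕 φ) (cyl (z, ⟪z, y⟫)) := by
  rw [SchwartzMap.fourier_coe, Real.fourier_eq, Real.fourier_eq, integral_eq_integral_lineMap y,
    Measure.volume_eq_prod, integral_prod]
  · simp only [inner_cyl, planeProj_lineMap, lineIntegral]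
    congr 1 with η
    simp only [Circle.smul_def]
    rw [integral_smul]
  · simp only [inner_cyl, planeProj_lineMap]
    have h := integrable_comp_lineMap φ y
    rw [Measure.volume_eq_prod] at h
    refine h.norm.mono' ?_ ?_
    · refine AEStronglyMeasurable.smul ?_ h.1
      exact (continuous_induced_rng.1 (Real.continuous_fourierChar.comp (by fun_prop :
        Continuous fun q : ℂ × ℝ => -⟪q.1, z⟫))).aestronglyMeasurable
    · filter_upwards with q
      rw [Circle.norm_smul]

/-- The Fourier transform decays on the plane `{(z, ⟪z, y⟫)}`, whatever its slope. -/
lemma exists_decay_slice (φ : 𝓢(E3, ℂ)) (y : ℂ) :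
    ∃ C : ℝ, 0 ≤ C ∧ ∀ z, ‖𝓕 (lineIntegral φ y) z‖ ≤ C * ((1 + ‖z‖) ^ 3)⁻¹ := by
  obtain ⟨C, hC0, hC⟩ := (𝓕 φ).exists_decay_cyl 3 0
  exact ⟨C, hC0, fun z => by simpa [fourier_lineIntegral] using hC (z, ⟪z, y⟫)⟩

lemma continuous_fourier_lineIntegral (φ : 𝓢(E3, ℂ)) (y : ℂ) :
    Continuous (𝓕 (lineIntegral φ y)) := by
  have : 𝓕 (lineIntegral φ y) = fun z => (𝓕 φ) (cyl (z, ⟪z, y⟫)) :=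
    funext (fourier_lineIntegral φ y)
  rw [this]
  exact (𝓕 φ).continuous.comp (by fun_prop)

lemma integrable_inv_one_add_norm_cube : Integrable fun z : ℂ => ((1 + ‖z‖) ^ 3)⁻¹ :=
  integrable_inv_one_add_norm_pow volume (by rw [Complex.finrank_real_complex]; norm_num)

lemma integrable_fourier_lineIntegral (φ : 𝓢(E3, ℂ)) (y : ℂ) :
    Integrable (𝓕 (lineIntegral φ y)) := by
  obtain ⟨C, hC0, hC⟩ := exists_decay_slice φ y
  exact (integrable_inv_one_add_norm_cube.const_mul C).mono'
    (continuous_fourier_lineIntegral φ y).aestronglyMeasurable (Filter.Eventually.of_forall hC)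

/-- The integral of the Fourier transform over a plane through the origin is the integral of the
function over the line orthogonal to it. -/
lemma integral_slice (φ : 𝓢(E3, ℂ)) (y : ℂ) :
    ∫ z : ℂ, (𝓕 φ) (cyl (z, ⟪z, y⟫)) = ∫ t : ℝ, φ (lineMap y (0, t)) := by
  have h := (integrable_lineIntegral φ y).fourierInv_fourier_eq (integrable_fourier_lineIntegral φ y)
    (continuous_lineIntegral φ y).continuousAt (v := 0)
  rw [Real.fourierInv_eq] at h
  simp only [inner_zero_right, AddChar.map_zero_eq_one, one_smul, fourier_lineIntegral] at h
  exact h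

/-! ### The Riesz potential in the plane -/

/-- Multiplication formula against a Gaussian in the plane. -/
lemma integral_gaussian_mul_fourier {f : ℂ → ℂ} (hf : Integrable f) {r : ℝ} (hr : 0 < r) :
    ∫ z : ℂ, (Real.exp (-(Real.pi * r * ‖z‖ ^ 2)) : ℂ) * 𝓕 f z =
      ∫ η : ℂ, ((r⁻¹ * Real.exp (-(Real.pi * ‖η‖ ^ 2 * r⁻¹)) : ℝ) : ℂ) * f η := by
  have hb : 0 < ((Real.pi * r : ℝ) : ℂ).re := by
    rw [Complex.ofReal_re]; exact mul_pos Real.pi_pos hr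
  have hg : Integrable fun z : ℂ => Complex.exp (-((Real.pi * r : ℝ) : ℂ) * ‖z‖ ^ 2) := by
    simpa using GaussianFourier.integrable_cexp_neg_mul_sq_norm_add hb 0 (0 : ℂ)
  have h := VectorFourier.integral_fourierIntegral_smul_eq_flip (L := innerₗ ℂ)
    Real.continuous_fourierChar continuous_inner hf hg
  have h1 : ∀ η : ℂ, VectorFourier.fourierIntegral Real.fourierChar volume (innerₗ ℂ).flip
      (fun z : ℂ => Complex.exp (-((Real.pi * r : ℝ) : ℂ) * ‖z‖ ^ 2)) η
      = ((r⁻¹ * Real.exp (-(Real.pi * ‖η‖ ^ 2 * r⁻¹)) : ℝ) : ℂ) := by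
    intro η
    rw [flip_innerₗ]
    have := fourier_gaussian_innerProductSpace hb η
    rw [Complex.finrank_real_complex] at this
    refine Eq.trans ?_ (this.trans ?_)
    · rfl
    · have hpi : (Real.pi : ℂ) ≠ 0 := by exact_mod_cast Real.pi_ne_zero
      have hrc : (r : ℂ) ≠ 0 := by exact_mod_cast hr.ne'
      push_cast
      rw [div_self two_ne_zero, Complex.cpow_one]
      congr 1
      · field_simp
      · congr 1
        field_simp
  simp only [h1] at h
  convert! h using 2
  · ext z
    rw [smul_eq_mul, mul_comm]
    congr 1
    push_cast
    congr 1
    ring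
  · ext η
    rw [smul_eq_mul, mul_comm]

lemma integral_rpow_mul_gaussian {a q : ℝ} (ha : 0 < a) (hq : 0 < q) :
    ∫ r in Set.Ioi (0 : ℝ), r ^ (a / 2 - 1) * Real.exp (-(Real.pi * r * q ^ 2)) =
      Real.pi ^ (-(a / 2)) * Real.Gamma (a / 2) * q ^ (-a) := by
  have h := Real.integral_rpow_mul_exp_neg_mul_Ioi (a := a / 2) (r := Real.pi * q ^ 2) (by linarith)
    (mul_pos Real.pi_pos (by positivity))
  have h2 : ∀ r : ℝ, Real.pi * r * q ^ 2 = Real.pi * q ^ 2 * r := fun r => by ring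
  simp only [h2]
  rw [h, one_div, Real.inv_rpow (by positivity), ← Real.rpow_neg (by positivity),
    Real.mul_rpow Real.pi_pos.le (by positivity), ← Real.rpow_natCast q 2, ← Real.rpow_mul hq.le]
  have : ((2 : ℕ) : ℝ) * -(a / 2) = -a := by push_cast; ring
  rw [this]
  ring

lemma integral_rpow_mul_gaussian_inv {a q : ℝ} (ha : a < 2) (hq : 0 < q) :
    ∫ r in Set.Ioi (0 : ℝ), r ^ (a / 2 - 1) * (r⁻¹ * Real.exp (-(Real.pi * q ^ 2 * r⁻¹))) =
      Real.pi ^ (-((2 - a) / 2)) * Real.Gamma ((2 - a) / 2) * q ^ (-(2 - a)) := by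
  rw [← integral_rpow_mul_gaussian (by linarith) hq,
    ← integral_comp_rpow_Ioi (fun r => r ^ ((2 - a) / 2 - 1) * Real.exp (-(Real.pi * r * q ^ 2)))
      (p := -1) (by norm_num)]
  refine setIntegral_congr_fun measurableSet_Ioi fun r hr => ?_
  have hr : 0 < r := hr
  simp only [abs_neg, abs_one, one_mul, smul_eq_mul, Real.rpow_neg_one]
  rw [Real.inv_rpow hr.le, ← Real.rpow_neg hr.le, ← mul_assoc, ← mul_assoc, ← Real.rpow_neg_one r,
    ← Real.rpow_add hr, ← Real.rpow_add hr]
  congr 2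
  · ring
  · ring

/-- The Fourier transform of `‖z‖⁻ᵃ` in the plane is a multiple of `‖η‖^(a - 2)`. -/
lemma integral_norm_rpow_mul_fourier {a : ℝ} (ha0 : 0 < a) (ha2 : a < 2) {f : ℂ → ℂ}
    (hf : Integrable f) (hf' : Integrable fun η : ℂ => ((‖η‖ ^ (-(2 - a)) : ℝ) : ℂ) * f η)
    (hF' : Integrable fun z : ℂ => ((‖z‖ ^ (-a) : ℝ) : ℂ) * 𝓕 f z) :
    ((Real.pi ^ (-(a / 2)) * Real.Gamma (a / 2) : ℝ) : ℂ) * ∫ z : ℂ, ((‖z‖ ^ (-a) : ℝ) : ℂ) * 𝓕 f z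
      = ((Real.pi ^ (-((2 - a) / 2)) * Real.Gamma ((2 - a) / 2) : ℝ) : ℂ) *
        ∫ η : ℂ, ((‖η‖ ^ (-(2 - a)) : ℝ) : ℂ) * f η := by
  -- Both sides are integrals over `r` of the Gaussian multiplication formula.
  have key : ∀ (k : ℝ → ℝ → ℝ) (c b : ℝ) (g : ℂ → ℂ), 0 < c → Measurable (Function.uncurry k) →
      (∀ r, 0 < r → ∀ q, 0 ≤ k r q) →
      (∀ q, 0 < q → ∫ r in Set.Ioi (0 : ℝ), k r q = c * q ^ (-b)) →
      AEStronglyMeasurable g →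
      (Integrable fun z : ℂ => ((‖z‖ ^ (-b) : ℝ) : ℂ) * g z) →
      (c : ℂ) * ∫ z : ℂ, ((‖z‖ ^ (-b) : ℝ) : ℂ) * g z
        = ∫ r in Set.Ioi (0 : ℝ), ∫ z : ℂ, (k r ‖z‖ : ℂ) * g z := by
    intro k c b g hc hkm hk0 hk hgm hg
    have hk' : ∀ z : ℂ, z ≠ 0 → IntegrableOn (fun r => k r ‖z‖) (Set.Ioi 0) := by
      intro z hz
      have hz' : 0 < ‖z‖ := norm_pos_iff.2 hz
      refine Integrable.of_integral_ne_zero ?_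
      rw [hk _ hz']
      positivity
    have hswap : Integrable (Function.uncurry fun (z : ℂ) (r : ℝ) => (k r ‖z‖ : ℂ) * g z)
        (volume.prod (volume.restrict (Set.Ioi 0))) := by
      rw [integrable_prod_iff]
      · constructor
        · filter_upwards [ae_ne_complex 0] with z hz
          exact Integrable.mul_const (Integrable.ofReal (𝕜 := ℂ) (hk' z hz)) (g z)
        · refine (hg.norm.const_mul c).congr ?_
          filter_upwards [ae_ne_complex 0] with z hz
          have hz' : 0 < ‖z‖ := norm_pos_iff.2 hz
          simp only [Function.uncurry, norm_mul, Complex.norm_real]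
          rw [integral_mul_const, Real.norm_of_nonneg (by positivity : 0 ≤ ‖z‖ ^ (-b)), ← mul_assoc,
            ← hk _ hz']
          congr 1
          refine setIntegral_congr_fun measurableSet_Ioi fun r hr => ?_
          exact (Real.norm_of_nonneg (hk0 r hr _)).symm
      · refine AEStronglyMeasurable.mul ?_ hgm.comp_fst
        have : Measurable fun q : ℂ × ℝ => k q.2 ‖q.1‖ :=
          hkm.comp (measurable_snd.prodMk measurable_fst.norm)
        exact this.complex_ofReal.aestronglyMeasurable
    rw [← integral_integral_swap hswap, ← integral_const_mul]
    refine integral_congr_ae ?_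
    filter_upwards [ae_ne_complex 0] with z hz
    rw [integral_mul_const, ← mul_assoc, ← Complex.ofReal_mul, ← hk _ (norm_pos_iff.2 hz)]
    congr 1
    exact integral_ofReal.symm
  have hG1 : 0 < Real.Gamma (a / 2) := Real.Gamma_pos_of_pos (by linarith)
  have hG2 : 0 < Real.Gamma ((2 - a) / 2) := Real.Gamma_pos_of_pos (by linarith)
  have hFc : Continuous (𝓕 f) :=
    VectorFourier.fourierIntegral_continuous Real.continuous_fourierChar
      (L := innerₗ ℂ) continuous_inner hf
  rw [key (fun r q => r ^ (a / 2 - 1) * Real.exp (-(Real.pi * r * q ^ 2))) _ _ _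
      (mul_pos (Real.rpow_pos_of_pos Real.pi_pos _) hG1) (by unfold Function.uncurry; fun_prop)
      (fun r hr q => by positivity) (fun q hq => integral_rpow_mul_gaussian ha0 hq)
      hFc.aestronglyMeasurable hF',
    key (fun r q => r ^ (a / 2 - 1) * (r⁻¹ * Real.exp (-(Real.pi * q ^ 2 * r⁻¹)))) _ _ _
      (mul_pos (Real.rpow_pos_of_pos Real.pi_pos _) hG2) (by unfold Function.uncurry; fun_prop)
      (fun r hr q => by positivity) (fun q hq => integral_rpow_mul_gaussian_inv ha2 hq)
      hf.aestronglyMeasurable hf']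
  refine setIntegral_congr_fun measurableSet_Ioi fun r hr => ?_
  have h := integral_gaussian_mul_fourier hf (r := r) hr
  simp only [Complex.ofReal_mul (r ^ (a / 2 - 1)), mul_assoc ((r ^ (a / 2 - 1) : ℝ) : ℂ)]
  rw [integral_const_mul, integral_const_mul, h]

/-! ### The Fourier transform of a band profile of degree `-s`, `1 < s < 2` -/

/-- Up to a positive constant, the Fourier transform of the great-circle superposition: a Riesz
potential of the density, since each plane contributes `‖planeProj y ξ‖^(-b)`, with `b = 3 - s`. -/
noncomputable def bandPotential (b : ℝ) (p : ℝ → ℝ) (ξ : E3) : ℝ :=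
  ∫ y : ℂ, ‖planeProj y ξ‖ ^ (-b) * p (‖y‖ ^ 2)

/-- The ratio of the constants in `integral_norm_rpow_mul_fourier`, for `a = s - 1`. -/
noncomputable def rieszRatio (s : ℝ) : ℝ :=
  (Real.pi ^ (-((2 - (s - 1)) / 2)) * Real.Gamma ((2 - (s - 1)) / 2)) /
    (Real.pi ^ (-((s - 1) / 2)) * Real.Gamma ((s - 1) / 2))

lemma rieszRatio_pos {s : ℝ} (h1 : 1 < s) (h3 : s < 3) : 0 < rieszRatio s := by
  have hG1 : 0 < Real.Gamma ((s - 1) / 2) := Real.Gamma_pos_of_pos (by linarith)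
  have hG2 : 0 < Real.Gamma ((2 - (s - 1)) / 2) := Real.Gamma_pos_of_pos (by linarith)
  have := Real.pi_pos
  unfold rieszRatio
  positivity

lemma two_sub_sub_one (s : ℝ) : 2 - (s - 1) = 3 - s := by ring

section Integrability

variable {b : ℝ}

lemma integrable_singularity (hb2 : b < 2) :
    Integrable fun q : ℂ × ℝ =>
      (closedBall (0 : ℂ) 1).indicator (fun z => ‖z‖ ^ (-b)) q.1 * ((1 + ‖q.2‖) ^ 2)⁻¹ := by
  rw [Measure.volume_eq_prod]
  refine Integrable.mul_prod (f := (closedBall (0 : ℂ) 1).indicator (fun z => ‖z‖ ^ (-b)))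
    (g := fun t : ℝ => ((1 + ‖t‖) ^ 2)⁻¹) ?_ (integrable_inv_one_add_norm_pow volume (by simp))
  rw [integrable_indicator_iff measurableSet_closedBall]
  exact integrableOn_closedBall_norm_rpow volume
    (by rw [Complex.finrank_real_complex]; exact_mod_cast hb2) 1

/-- Domination of the singular integrand, uniform in the slope `y` of the plane. -/
lemma norm_rpow_mul_le {C : ℝ} {φ : 𝓢(E3, ℂ)} (hb0 : 0 ≤ b)
    (hC : ∀ y q, ‖φ (lineMap y q)‖ ≤ C * ((1 + ‖q.2‖) ^ 2)⁻¹) (y : ℂ) (q : ℂ × ℝ) :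
    ‖q.1‖ ^ (-b) * ‖φ (lineMap y q)‖ ≤
      C * ((closedBall (0 : ℂ) 1).indicator (fun z => ‖z‖ ^ (-b)) q.1 * ((1 + ‖q.2‖) ^ 2)⁻¹)
        + ‖φ (lineMap y q)‖ := by
  by_cases hq : q.1 ∈ closedBall (0 : ℂ) 1
  · rw [Set.indicator_of_mem hq, mul_left_comm C]
    have := mul_le_mul_of_nonneg_left (hC y q) (Real.rpow_nonneg (norm_nonneg q.1) (-b))
    linarith [norm_nonneg (φ (lineMap y q))]
  · rw [Set.indicator_of_notMem hq, zero_mul, mul_zero, zero_add]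
    refine mul_le_of_le_one_left (norm_nonneg _) ?_
    apply Real.rpow_le_one_of_one_le_of_nonpos _ (by linarith)
    simp at hq; exact hq.le

lemma measurable_norm_rpow_fst : Measurable fun q : ℂ × ℝ => ((‖q.1‖ ^ (-b) : ℝ) : ℂ) :=
  Measurable.complex_ofReal (by fun_prop)

lemma integrable_norm_rpow_mul_lineMap (hb0 : 0 ≤ b) (hb2 : b < 2) (φ : 𝓢(E3, ℂ)) (y : ℂ) :
    Integrable fun q : ℂ × ℝ => ((‖q.1‖ ^ (-b) : ℝ) : ℂ) * φ (lineMap y q) := by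
  obtain ⟨C, hC0, hC⟩ := exists_decay_lineMap φ 2
  refine (((integrable_singularity hb2).const_mul C).add
    (integrable_comp_lineMap φ y).norm).mono' ?_ ?_
  · exact measurable_norm_rpow_fst.aestronglyMeasurable.mul (integrable_comp_lineMap φ y).1
  · filter_upwards with q
    rw [norm_mul, Complex.norm_real, Real.norm_of_nonneg (by positivity)]
    exact norm_rpow_mul_le hb0 hC y q

lemma integral_norm_rpow_mul_lineIntegral (hb0 : 0 ≤ b) (hb2 : b < 2) (φ : 𝓢(E3, ℂ)) (y : ℂ) :
    (Integrable fun η : ℂ => ((‖η‖ ^ (-b) : ℝ) : ℂ) * lineIntegral φ y η) ∧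
    ∫ η : ℂ, ((‖η‖ ^ (-b) : ℝ) : ℂ) * lineIntegral φ y η =
      ∫ ξ : E3, ((‖planeProj y ξ‖ ^ (-b) : ℝ) : ℂ) * φ ξ := by
  have h := integrable_norm_rpow_mul_lineMap hb0 hb2 φ y
  rw [Measure.volume_eq_prod] at h
  have h1 : ∀ η : ℂ, ∫ t : ℝ, ((‖η‖ ^ (-b) : ℝ) : ℂ) * φ (lineMap y (η, t)) =
      ((‖η‖ ^ (-b) : ℝ) : ℂ) * lineIntegral φ y η := fun η => integral_const_mul _ _
  constructor
  · exact h.integral_prod_left.congr (Filter.Eventually.of_forall h1)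
  · rw [integral_eq_integral_lineMap y, Measure.volume_eq_prod]
    simp only [planeProj_lineMap]
    rw [integral_prod _ h]
    simp only [h1]

lemma integrable_density_mul_planeProj {R : ℝ} {p : ℝ → ℝ} (hp : IsRadialDensity R p)
    (hb0 : 0 ≤ b) (hb2 : b < 2) (φ : 𝓢(E3, ℂ)) :
    Integrable (fun a : ℂ × E3 =>
      (p (‖a.1‖ ^ 2) : ℂ) * (((‖planeProj a.1 a.2‖ ^ (-b) : ℝ) : ℂ) * φ a.2))
      (volume.prod volume) := by
  obtain ⟨C, hC0, hC⟩ := exists_decay_lineMap φ 2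
  have hmp : MeasurePreserving (fun a : ℂ × (ℂ × ℝ) => (a.1, lineMap a.1 a.2))
      (volume.prod volume) (volume.prod volume) :=
    (MeasurePreserving.id volume).skew_product (g := lineMap) continuous_lineMap.measurable
      (Filter.Eventually.of_forall fun y => (measurePreserving_lineMap y).map_eq)
  have hpm : Measurable fun y : ℂ => (p (‖y‖ ^ 2) : ℂ) := hp.continuous_density.measurable.complex_ofReal
  have hm : Measurable fun a : ℂ × E3 =>
      (p (‖a.1‖ ^ 2) : ℂ) * (((‖planeProj a.1 a.2‖ ^ (-b) : ℝ) : ℂ) * φ a.2) := by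
    refine (hpm.comp measurable_fst).mul (Measurable.mul ?_ (φ.continuous.measurable.comp measurable_snd))
    exact ((continuous_planeProj.measurable.norm).pow_const _).complex_ofReal
  rw [← hmp.integrable_comp hm.aestronglyMeasurable]
  have hd1 : Integrable (fun a : ℂ × (ℂ × ℝ) => ‖p (‖a.1‖ ^ 2)‖ *
      (C * ((closedBall (0 : ℂ) 1).indicator (fun z => ‖z‖ ^ (-b)) a.2.1 * ((1 + ‖a.2.2‖) ^ 2)⁻¹)))
      (volume.prod volume) :=
    hp.integrable_density.norm.mul_prod ((integrable_singularity hb2).const_mul C)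
  have hd2 : Integrable (fun a : ℂ × (ℂ × ℝ) => ‖p (‖a.1‖ ^ 2)‖ * ‖φ (lineMap a.1 a.2)‖)
      (volume.prod volume) :=
    hmp.integrable_comp_of_integrable (hp.integrable_density.norm.mul_prod φ.integrable.norm)
  refine (hd1.add hd2).mono' (hm.comp hmp.measurable).aestronglyMeasurable ?_
  filter_upwards with a
  simp only [Function.comp, planeProj_lineMap, norm_mul, Complex.norm_real, Pi.add_apply]
  rw [← mul_add, Real.norm_of_nonneg (by positivity : 0 ≤ ‖a.2.1‖ ^ (-b))]
  exact mul_le_mul_of_nonneg_left (norm_rpow_mul_le hb0 hC a.1 a.2) (norm_nonneg _)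

end Integrability

/-- The Fourier pairing of a band profile. -/
lemma integral_bandProfile_mul_fourier {R : ℝ} {p : ℝ → ℝ} (hp : IsRadialDensity R p) {s : ℝ}
    (h1 : 1 < s) (h3 : s < 3) (φ : 𝓢(E3, ℂ)) :
    ∫ x : E3, (homogeneousExt (-s) (bandProfile s p) x : ℂ) * (𝓕 φ) x =
      ∫ ξ : E3, ((rieszRatio s * bandPotential (3 - s) p ξ : ℝ) : ℂ) * φ ξ := by
  rw [integral_homogeneousExt_bandProfile_mul hp h1.le h3]
  have hslice : ∀ y : ℂ, ∫ z : ℂ, ((‖z‖ ^ (-(s - 1)) : ℝ) : ℂ) * (𝓕 φ) (cyl (z, ⟪z, y⟫)) =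
      (rieszRatio s : ℂ) * ∫ ξ : E3, ((‖planeProj y ξ‖ ^ (-(3 - s)) : ℝ) : ℂ) * φ ξ := by
    intro y
    obtain ⟨hi, he⟩ := integral_norm_rpow_mul_lineIntegral (b := 3 - s) (by linarith) (by linarith) φ y
    rw [← he, rieszRatio]
    obtain ⟨C, hC0, hC⟩ := exists_decay_slice φ y
    have hF : Integrable fun z : ℂ => ((‖z‖ ^ (-(s - 1)) : ℝ) : ℂ) * 𝓕 (lineIntegral φ y) z := by
      refine (integrable_norm_rpow_mul volume (b := s - 1) (by linarith)
        (by rw [Complex.finrank_real_complex]; push_cast; linarith)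
        (integrable_fourier_lineIntegral φ y).norm (C := C) ?_).mono' ?_ ?_
      · intro z
        rw [abs_norm]
        exact (hC z).trans (mul_le_of_le_one_right hC0 (inv_one_add_norm_pow_le_one z 3))
      · exact (Measurable.complex_ofReal (by fun_prop)).aestronglyMeasurable.mul
          (integrable_fourier_lineIntegral φ y).1
      · filter_upwards with z
        rw [norm_mul, Complex.norm_real, Real.norm_of_nonneg (by positivity)]
    have h := integral_norm_rpow_mul_fourier (a := s - 1) (by linarith) (by linarith)
      (integrable_lineIntegral φ y) (by rwa [two_sub_sub_one]) hF
    rw [two_sub_sub_one] at h ⊢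
    simp only [fourier_lineIntegral] at h
    have hG1 : 0 < Real.Gamma ((s - 1) / 2) := Real.Gamma_pos_of_pos (by linarith)
    have hne : ((Real.pi ^ (-((s - 1) / 2)) * Real.Gamma ((s - 1) / 2) : ℝ) : ℂ) ≠ 0 := by
      have := Real.pi_pos
      exact_mod_cast (by positivity :
        0 < Real.pi ^ (-((s - 1) / 2)) * Real.Gamma ((s - 1) / 2)).ne'
    rw [Complex.ofReal_div, div_mul_eq_mul_div, eq_div_iff hne, mul_comm, h]
  simp only [hslice]
  have hswap := integrable_density_mul_planeProj hp (b := 3 - s) (by linarith) (by linarith) φ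
  have e1 : ∀ y : ℂ, (p (‖y‖ ^ 2) : ℂ) *
      ((rieszRatio s : ℂ) * ∫ ξ : E3, ((‖planeProj y ξ‖ ^ (-(3 - s)) : ℝ) : ℂ) * φ ξ) =
      (rieszRatio s : ℂ) *
        ∫ ξ : E3, (p (‖y‖ ^ 2) : ℂ) * (((‖planeProj y ξ‖ ^ (-(3 - s)) : ℝ) : ℂ) * φ ξ) := by
    intro y
    rw [integral_const_mul]
    ring
  simp only [e1]
  rw [integral_const_mul, integral_integral_swap (f := fun y ξ => (p (‖y‖ ^ 2) : ℂ) *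
    (((‖planeProj y ξ‖ ^ (-(3 - s)) : ℝ) : ℂ) * φ ξ)) hswap, ← integral_const_mul]
  congr 1 with ξ
  have e2 : ∫ y : ℂ, (p (‖y‖ ^ 2) : ℂ) * (((‖planeProj y ξ‖ ^ (-(3 - s)) : ℝ) : ℂ) * φ ξ) =
      (bandPotential (3 - s) p ξ : ℂ) * φ ξ := by
    simp only [← mul_assoc]
    rw [integral_mul_const, bandPotential]
    congr 1
    refine Eq.trans ?_ integral_ofReal
    congr 1 with y
    rw [mul_comm, ← Complex.ofReal_mul]
    rfl
  rw [e2, Complex.ofReal_mul, mul_assoc]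

lemma planeProj_smul (y : ℂ) (c : ℝ) (ξ : E3) : planeProj y (c • ξ) = c • planeProj y ξ := by
  simp only [planeProj, map_smul, PiLp.smul_apply, smul_eq_mul, smul_add, mul_smul]

/-- The angle function of the Fourier transform of a band profile. -/
noncomputable def bandAngle (s : ℝ) (p : ℝ → ℝ) (σ : S2) : ℝ :=
  rieszRatio s * bandPotential (3 - s) p (σ : E3)

lemma homogeneousExt_bandAngle (s : ℝ) (p : ℝ → ℝ) {ξ : E3} (hξ : ξ ≠ 0) :
    homogeneousExt (-3 + s) (bandAngle s p) ξ = rieszRatio s * bandPotential (3 - s) p ξ := by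
  have hξ' : 0 < ‖ξ‖ := norm_pos_iff.2 hξ
  have h : ∀ y : ℂ, ‖planeProj y (direction ξ hξ : E3)‖ ^ (-(3 - s)) * p (‖y‖ ^ 2)
      = ‖ξ‖ ^ (3 - s) * (‖planeProj y ξ‖ ^ (-(3 - s)) * p (‖y‖ ^ 2)) := by
    intro y
    rw [direction, planeProj_smul, norm_smul, norm_inv, norm_norm,
      Real.mul_rpow (by positivity) (by positivity), Real.inv_rpow hξ'.le, ← Real.rpow_neg hξ'.le,
      neg_neg, mul_assoc]
  rw [homogeneousExt_of_ne hξ, bandAngle, bandPotential]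
  simp only [h]
  rw [integral_const_mul, mul_left_comm, ← mul_assoc (‖ξ‖ ^ (-3 + s)), ← Real.rpow_add hξ']
  have : -3 + s + (3 - s) = 0 := by ring
  rw [this, Real.rpow_zero, one_mul, bandPotential]

/-! ### Continuity and positivity of the potential -/

section Potential

variable {R : ℝ} {p : ℝ → ℝ} {b : ℝ}

lemma norm_planeProj_of_ne {ξ : E3} (h : ξ 2 ≠ 0) (y : ℂ) :
    ‖planeProj y ξ‖ = |ξ 2| * ‖(ξ 2)⁻¹ • horiz ξ + y‖ := by
  rw [← Real.norm_eq_abs, ← norm_smul, smul_add, smul_inv_smul₀ h, planeProj]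

lemma integrable_norm_add_rpow_mul (hp : IsRadialDensity R p) (hb0 : 0 ≤ b) (hb2 : b < 2) (w : ℂ) :
    Integrable fun y : ℂ => ‖w + y‖ ^ (-b) * p (‖y‖ ^ 2) := by
  obtain ⟨M, hM0, hM⟩ := hp.exists_bound
  have h : Integrable fun v : ℂ => ‖v‖ ^ (-b) * p (‖v - w‖ ^ 2) :=
    integrable_norm_rpow_mul volume hb0 (by rw [Complex.finrank_real_complex]; exact_mod_cast hb2)
      (hp.integrable_density.comp_sub_right w) (fun v => hM (v - w))
  simpa using h.comp_add_left w

lemma integrable_bandPotential (hp : IsRadialDensity R p) (hb0 : 0 ≤ b) (hb2 : b < 2) (ξ : E3) :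
    Integrable fun y : ℂ => ‖planeProj y ξ‖ ^ (-b) * p (‖y‖ ^ 2) := by
  by_cases h : ξ 2 = 0
  · simp only [planeProj, h, zero_smul, add_zero]
    exact hp.integrable_density.const_mul _
  · simp only [norm_planeProj_of_ne h]
    refine ((integrable_norm_add_rpow_mul hp hb0 hb2 ((ξ 2)⁻¹ • horiz ξ)).const_mul
      (|ξ 2| ^ (-b))).congr (Filter.Eventually.of_forall fun y => ?_)
    simp only
    rw [Real.mul_rpow (abs_nonneg _) (norm_nonneg _), mul_assoc]

lemma bandPotential_of_ne {ξ : E3} (h : ξ 2 ≠ 0) :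
    bandPotential b p ξ = |ξ 2| ^ (-b) * ∫ y : ℂ, ‖(ξ 2)⁻¹ • horiz ξ + y‖ ^ (-b) * p (‖y‖ ^ 2) := by
  rw [bandPotential, ← integral_const_mul]
  congr 1 with y
  rw [norm_planeProj_of_ne h, Real.mul_rpow (abs_nonneg _) (norm_nonneg _), mul_assoc]

lemma continuous_rieszPotential (hp : IsRadialDensity R p) (hb2 : b < 2) :
    Continuous fun w : ℂ => ∫ y : ℂ, ‖w + y‖ ^ (-b) * p (‖y‖ ^ 2) := by
  have hloc : LocallyIntegrable (fun v : ℂ => ‖v‖ ^ (-b)) volume := by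
    refine locallyIntegrable_of_norm_le_rpow (C := 1) (α := b) Module.finrank_pos
      (by rw [Complex.finrank_real_complex]; exact_mod_cast hb2) ?_
      (Measurable.aestronglyMeasurable (by fun_prop))
    filter_upwards with x
    rw [Real.norm_of_nonneg (by positivity), one_mul]
  have h := hp.hasCompactSupport_density.continuous_convolution_right
    (ContinuousLinearMap.mul ℝ ℝ) hloc hp.continuous_density
  convert! h using 1
  ext w
  rw [convolution_def, ← integral_add_left_eq_self (fun v : ℂ =>
    (ContinuousLinearMap.mul ℝ ℝ (‖v‖ ^ (-b))) (p (‖w - v‖ ^ 2))) w]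
  congr 1 with y
  simp

lemma continuousAt_bandPotential (hp : IsRadialDensity R p) (hb0 : 0 ≤ b) (hb2 : b < 2) {ξ : E3}
    (hξ : ξ ≠ 0) : ContinuousAt (bandPotential b p) ξ := by
  have hc2 : Continuous fun ζ : E3 => ζ 2 := by fun_prop
  by_cases h : ξ 2 = 0
  · -- no plane in the support of the density is orthogonal to a vector close to `ξ`
    have hh : horiz ξ ≠ 0 := by
      intro h0
      apply hξ
      rw [← cyl_horiz ξ, h0, h]
      exact map_zero cyl
    have hpos : 0 < ‖horiz ξ‖ := norm_pos_iff.2 hh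
    have hev : ∀ᶠ ζ : E3 in nhds ξ, ‖horiz ξ‖ / 2 < ‖horiz ζ‖ - |ζ 2| * |R| := by
      refine ContinuousAt.eventually_lt (f := fun _ : E3 => ‖horiz ξ‖ / 2)
        (g := fun ζ : E3 => ‖horiz ζ‖ - |ζ 2| * |R|) continuousAt_const ?_ ?_
      · exact (horiz.continuous.norm.sub (hc2.abs.mul continuous_const)).continuousAt
      · simp only [h, abs_zero, zero_mul, sub_zero]; linarith
    refine continuousAt_of_dominated (bound := fun y : ℂ => (‖horiz ξ‖ / 2) ^ (-b) * |p (‖y‖ ^ 2)|)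
      ?_ ?_ ?_ ?_
    · exact Filter.Eventually.of_forall fun ζ => (integrable_bandPotential hp hb0 hb2 ζ).1
    · filter_upwards [hev] with ζ hζ
      filter_upwards with y
      by_cases hy : |R| ≤ ‖y‖
      · rw [hp.density_eq_zero hy]; simp
      · push Not at hy
        rw [norm_mul, Real.norm_of_nonneg (by positivity), Real.norm_eq_abs]
        refine mul_le_mul_of_nonneg_right ?_ (abs_nonneg _)
        refine Real.rpow_le_rpow_of_nonpos (by positivity) ?_ (by linarith)
        have h1 : ‖horiz ζ‖ - ‖ζ 2 • y‖ ≤ ‖planeProj y ζ‖ := norm_sub_le_norm_add _ _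
        rw [norm_smul, Real.norm_eq_abs] at h1
        have h2 : |ζ 2| * ‖y‖ ≤ |ζ 2| * |R| := by gcongr
        linarith
    · exact hp.integrable_density.abs.const_mul _
    · filter_upwards with y
      have hcont : ContinuousAt (fun ζ : E3 => ‖planeProj y ζ‖) ξ :=
        (continuous_planeProj.comp (by fun_prop : Continuous fun ζ : E3 => (y, ζ))).norm.continuousAt
      refine (hcont.rpow_const (Or.inl ?_)).mul continuousAt_const
      simp [planeProj, h, hh]
  · have hev : ∀ᶠ ζ : E3 in nhds ξ, ζ 2 ≠ 0 := hc2.continuousAt.eventually_ne h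
    have heq : bandPotential b p =ᶠ[nhds ξ] fun ζ =>
        |ζ 2| ^ (-b) * ∫ y : ℂ, ‖(ζ 2)⁻¹ • horiz ζ + y‖ ^ (-b) * p (‖y‖ ^ 2) := by
      filter_upwards [hev] with ζ hζ
      exact bandPotential_of_ne hζ
    refine ContinuousAt.congr ?_ heq.symm
    refine ContinuousAt.mul ?_ ?_
    · exact hc2.abs.continuousAt.rpow_const (Or.inl (abs_ne_zero.2 h))
    · exact ContinuousAt.comp (f := fun ζ : E3 => (ζ 2)⁻¹ • horiz ζ)
        (continuous_rieszPotential hp hb2).continuousAt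
        ((hc2.continuousAt.inv₀ h).smul horiz.continuous.continuousAt)

lemma bandPotential_pos (hp : IsRadialDensity R p) (hb0 : 0 ≤ b) (hb2 : b < 2)
    (hp0 : ∀ u, 0 ≤ p u) (hR : ∀ u, u < R ^ 2 → 0 < p u) (hRpos : 0 < R) {ξ : E3} (hξ : ξ ≠ 0) :
    0 < bandPotential b p ξ := by
  rw [bandPotential, integral_pos_iff_support_of_nonneg (fun y => mul_nonneg (by positivity) (hp0 _))
    (integrable_bandPotential hp hb0 hb2 ξ)]
  -- the integrand is positive on the disc of radius `R` except at one point at most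
  have hsub : ball (0 : ℂ) R \ {-((ξ 2)⁻¹ • horiz ξ)} ⊆
      Function.support fun y : ℂ => ‖planeProj y ξ‖ ^ (-b) * p (‖y‖ ^ 2) := by
    rintro y ⟨hy, hy'⟩
    rw [mem_ball_zero_iff] at hy
    have h1 : 0 < p (‖y‖ ^ 2) := hR _ (by gcongr)
    have h2 : 0 < ‖planeProj y ξ‖ := by
      rw [norm_pos_iff]
      intro h0
      by_cases h : ξ 2 = 0
      · apply hξ
        have h3 : horiz ξ = 0 := by simpa [planeProj, h] using h0
        rw [← cyl_horiz ξ, h3, h]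
        exact map_zero cyl
      · apply hy'
        have h3 := norm_planeProj_of_ne h y
        rw [h0, norm_zero, eq_comm, mul_eq_zero, or_iff_right (abs_ne_zero.2 h), norm_eq_zero] at h3
        rw [Set.mem_singleton_iff, eq_neg_iff_add_eq_zero, add_comm]
        exact h3
    exact (mul_pos (Real.rpow_pos_of_pos h2 _) h1).ne'
  refine lt_of_lt_of_le ?_ (measure_mono hsub)
  rw [measure_sdiff_null (measure_singleton _)]
  exact measure_ball_pos _ _ hRpos

end Potential

lemma continuous_bandAngle {R : ℝ} {p : ℝ → ℝ} (hp : IsRadialDensity R p) {s : ℝ} (h1 : 1 < s)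
    (h3 : s ≤ 3) : Continuous (bandAngle s p) := by
  refine continuous_const.mul (continuous_iff_continuousAt.2 fun σ => ?_)
  have hσ : (σ : E3) ≠ 0 := ne_zero_of_mem_unit_sphere σ
  exact (continuousAt_bandPotential hp (b := 3 - s) (by linarith) (by linarith) hσ).comp
    continuous_subtype_val.continuousAt

lemma ae_ne_zero_E3 : ∀ᵐ x : E3, x ≠ 0 := by simp [ae_iff]

theorem isFourierAngleFunction_bandAngle {R : ℝ} {p : ℝ → ℝ} (hp : IsRadialDensity R p) {s : ℝ}
    (h1 : 1 < s) (h3 : s < 3) : IsFourierAngleFunction s (bandProfile s p) (bandAngle s p) where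
  continuous := continuous_bandAngle hp h1 h3.le
  fourier φ := by
    rw [integral_bandProfile_mul_fourier hp h1 h3]
    refine integral_congr_ae ?_
    filter_upwards [ae_ne_zero_E3] with ξ hξ
    rw [homogeneousExt_bandAngle s p hξ]

/-! ### The Fourier transform of a band profile of degree `-1` -/

/-- For `s = 1` the transform of each plane lives on the orthogonal line, and the superposition is
the density itself at radius `‖horiz σ‖ / |σ₃|`, times the Jacobian `σ₃⁻²`. On the equator `σ₃ = 0` the
divisions by zero give `0`, which is also the limit. -/
noncomputable def bandAngleOne (p : ℝ → ℝ) (σ : S2) : ℝ :=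
  p (‖horiz (σ : E3)‖ ^ 2 / (σ : E3) 2 ^ 2) / (σ : E3) 2 ^ 2

lemma homogeneousExt_bandAngleOne (p : ℝ → ℝ) {ξ : E3} (hξ : ξ ≠ 0) :
    homogeneousExt (-2) (bandAngleOne p) ξ = p (‖horiz ξ‖ ^ 2 / ξ 2 ^ 2) / ξ 2 ^ 2 := by
  have hξ' : 0 < ‖ξ‖ := norm_pos_iff.2 hξ
  rw [homogeneousExt_of_ne hξ, bandAngleOne, horiz_direction, direction_two, norm_smul, norm_inv,
    norm_norm, mul_pow, mul_pow, mul_div_mul_left _ _ (by positivity : (‖ξ‖⁻¹) ^ 2 ≠ 0),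
    Real.rpow_neg hξ'.le]
  have : ‖ξ‖ ^ (2 : ℝ) = ‖ξ‖ ^ 2 := by exact_mod_cast Real.rpow_natCast ‖ξ‖ 2
  rw [this]
  field_simp

lemma continuous_bandAngleOne {R : ℝ} {p : ℝ → ℝ} (hp : IsRadialDensity R p) :
    Continuous (bandAngleOne p) := by
  have hc2 : Continuous fun σ : S2 => (σ : E3) 2 :=
    (by fun_prop : Continuous fun x : E3 => x 2).comp continuous_subtype_val
  have hch : Continuous fun σ : S2 => ‖horiz (σ : E3)‖ :=
    (horiz.continuous.comp continuous_subtype_val).norm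
  refine continuous_iff_continuousAt.2 fun σ => ?_
  by_cases h : (σ : E3) 2 = 0
  · have hev : ∀ᶠ τ : S2 in nhds σ, R ^ 2 * (τ : E3) 2 ^ 2 < ‖horiz (τ : E3)‖ ^ 2 := by
      refine ContinuousAt.eventually_lt (f := fun τ : S2 => R ^ 2 * (τ : E3) 2 ^ 2)
        (g := fun τ : S2 => ‖horiz (τ : E3)‖ ^ 2) ?_ ?_ ?_
      · exact (continuous_const.mul (hc2.pow 2)).continuousAt
      · exact (hch.pow 2).continuousAt
      · have := sphere_norm_sq σ
        simp only [h] at this ⊢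
        nlinarith
    refine ContinuousAt.congr (continuousAt_const (y := (0 : ℝ))) ?_
    filter_upwards [hev] with τ hτ
    rw [bandAngleOne]
    by_cases h2 : (τ : E3) 2 = 0
    · simp [h2]
    · rw [hp.eq_zero, zero_div]
      rw [le_div_iff₀ (by positivity)]
      exact hτ.le
  · have hne : (σ : E3) 2 ^ 2 ≠ 0 := pow_ne_zero 2 h
    refine ContinuousAt.div ?_ (hc2.pow 2).continuousAt hne
    exact ContinuousAt.comp (g := p) (f := fun τ : S2 => ‖horiz (τ : E3)‖ ^ 2 / (τ : E3) 2 ^ 2)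
      hp.smooth.continuous.continuousAt
      ((hch.pow 2).continuousAt.div (hc2.pow 2).continuousAt hne)

theorem isFourierAngleFunction_bandAngleOne {R : ℝ} {p : ℝ → ℝ} (hp : IsRadialDensity R p) :
    IsFourierAngleFunction 1 (bandProfile 1 p) (bandAngleOne p) where
  continuous := continuous_bandAngleOne hp
  fourier φ := by
    have hexp : (-3 + 1 : ℝ) = -2 := by norm_num
    rw [integral_homogeneousExt_bandProfile_mul hp le_rfl (by norm_num), hexp]
    have e1 : ∀ y : ℂ, ∫ z : ℂ, ((‖z‖ ^ (-((1 : ℝ) - 1)) : ℝ) : ℂ) * (𝓕 φ) (cyl (z, ⟪z, y⟫)) =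
        ∫ t : ℝ, φ (lineMap y (0, t)) := by
      intro y
      rw [← integral_slice]
      simp
    have hint := integrable_homogeneousExt_mul (continuous_bandAngleOne hp) (b := 2) (by norm_num)
      (by norm_num) φ
    rw [integrable_iff_integrable_cyl, Measure.volume_eq_prod] at hint
    simp only [e1, ← integral_const_mul]
    rw [integral_eq_integral_cyl, Measure.volume_eq_prod, integral_prod_symm _ hint,
      integral_integral_swap]
    · refine integral_congr_ae ?_
      have hae : ∀ᵐ t : ℝ, t ≠ 0 := by simp [ae_iff]
      filter_upwards [hae] with t ht
      have hs := Measure.integral_comp_smul (volume : Measure ℂ)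
        (fun h : ℂ => (p (‖h‖ ^ 2 / t ^ 2) : ℂ) * φ (cyl (h, t))) (-t)
      have e2 : ∀ y : ℂ, (p (‖y‖ ^ 2) : ℂ) * φ (lineMap y (0, t)) =
          (p (‖(-t) • y‖ ^ 2 / t ^ 2) : ℂ) * φ (cyl ((-t) • y, t)) := by
        intro y
        rw [norm_smul, mul_pow, norm_neg, Real.norm_eq_abs, sq_abs,
          mul_div_cancel_left₀ _ (pow_ne_zero 2 ht), lineMap, zero_sub, neg_smul]
      simp only [e2]
      rw [hs, Complex.finrank_real_complex, ← integral_smul]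
      congr 1 with h
      have hne : cyl (h, t) ≠ 0 := fun h0 => ht (by simpa using congrArg (fun x : E3 => x 2) h0)
      rw [homogeneousExt_bandAngleOne p hne, horiz_cyl, cyl_apply_two, Complex.real_smul]
      simp only [even_two, Even.neg_pow, abs_inv, abs_pow, sq_abs]
      push_cast
      ring
    · obtain ⟨C, hC0, hC⟩ := exists_decay_lineMap φ 2
      have hdom := hp.integrable_density.norm.mul_prod
        ((integrable_inv_one_add_norm_pow (E := ℝ) volume (k := 2) (by simp)).const_mul C)
      refine hdom.mono' ?_ ?_
      · refine AEStronglyMeasurable.mul ?_ ?_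
        · exact ((Complex.continuous_ofReal.comp hp.continuous_density).comp
            continuous_fst).aestronglyMeasurable
        · exact (φ.continuous.comp (continuous_lineMap.comp (by fun_prop :
            Continuous fun a : ℂ × ℝ => (a.1, ((0 : ℂ), a.2))))).aestronglyMeasurable
      · filter_upwards with a
        simp only [Function.uncurry, norm_mul, Complex.norm_real]
        exact mul_le_mul_of_nonneg_left (hC a.1 (0, a.2)) (norm_nonneg _)

/-! ### Two densities -/

/-- A smooth nonnegative density, positive exactly on the open disc of radius `R` and radially
decreasing. -/
noncomputable def bumpDensity (R : ℝ) (u : ℝ) : ℝ := expNegInvGlue (R ^ 2 - u)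

/-- The difference of `bumpDensity` and of its concentration on the disc of half the radius,
normalized so that the Abel transform vanishes at `0`. -/
noncomputable def diffDensity (R : ℝ) (u : ℝ) : ℝ := bumpDensity R u - 2 * bumpDensity R (4 * u)

section Densities

variable (R : ℝ)

lemma isRadialDensity_bumpDensity : IsRadialDensity R (bumpDensity R) where
  smooth := expNegInvGlue.contDiff.comp (contDiff_const.sub contDiff_id)
  eq_zero u hu := expNegInvGlue.zero_of_nonpos (by linarith)

lemma isRadialDensity_diffDensity : IsRadialDensity R (diffDensity R) where
  smooth := (isRadialDensity_bumpDensity R).smooth.sub (contDiff_const.mul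
    ((isRadialDensity_bumpDensity R).smooth.comp (contDiff_const.mul contDiff_id)))
  eq_zero u hu := by
    rw [diffDensity, (isRadialDensity_bumpDensity R).eq_zero u hu,
      (isRadialDensity_bumpDensity R).eq_zero (4 * u) (by nlinarith [sq_nonneg R])]
    ring

variable {R}

lemma bumpDensity_nonneg (u : ℝ) : 0 ≤ bumpDensity R u := expNegInvGlue.nonneg _

lemma bumpDensity_pos {u : ℝ} (h : u < R ^ 2) : 0 < bumpDensity R u :=
  expNegInvGlue.pos_of_pos (by linarith)

lemma bumpDensity_anti {u v : ℝ} (h : u ≤ v) : bumpDensity R v ≤ bumpDensity R u :=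
  expNegInvGlue.monotone (by linarith)

lemma abel_bumpDensity_nonneg (t : ℝ) : 0 ≤ abel (bumpDensity R) t :=
  integral_nonneg fun _ => bumpDensity_nonneg _

lemma integrable_bumpDensity_line (t : ℝ) : Integrable fun v : ℝ => bumpDensity R (t ^ 2 + v ^ 2) := by
  have hp := isRadialDensity_bumpDensity R
  apply Continuous.integrable_of_hasCompactSupport
  · exact hp.smooth.continuous.comp (by fun_prop)
  · refine HasCompactSupport.intro (isCompact_closedBall 0 |R|) fun v hv => hp.eq_zero _ ?_
    have : |R| ≤ |v| := by simp at hv; exact hv.le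
    nlinarith [sq_nonneg t, sq_le_sq.2 this]

lemma abel_bumpDensity_zero_pos (hR : 0 < R) : 0 < abel (bumpDensity R) 0 := by
  rw [abel, integral_pos_iff_support_of_nonneg (fun _ => bumpDensity_nonneg _)
    (integrable_bumpDensity_line 0)]
  refine lt_of_lt_of_le (measure_ball_pos volume (0 : ℝ) hR) (measure_mono fun v hv => ?_)
  refine (bumpDensity_pos ?_).ne'
  rw [mem_ball_zero_iff, Real.norm_eq_abs] at hv
  rw [zero_pow two_ne_zero, zero_add, ← sq_abs v]
  gcongr

lemma abel_diffDensity (t : ℝ) :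
    abel (diffDensity R) t = abel (bumpDensity R) t - abel (bumpDensity R) (2 * t) := by
  have h2 : ∫ v : ℝ, bumpDensity R ((2 * t) ^ 2 + (2 * v) ^ 2) =
      2⁻¹ * abel (bumpDensity R) (2 * t) := by
    have := Measure.integral_comp_mul_left
      (fun v : ℝ => bumpDensity R ((2 * t) ^ 2 + v ^ 2)) 2
    rw [this, abel, smul_eq_mul, abs_of_pos (by norm_num)]
  have hi : Integrable fun v : ℝ => bumpDensity R ((2 * t) ^ 2 + (2 * v) ^ 2) :=
    (integrable_bumpDensity_line (2 * t)).comp_mul_left' two_ne_zero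
  have h4 : ∀ v : ℝ, diffDensity R (t ^ 2 + v ^ 2) = bumpDensity R (t ^ 2 + v ^ 2)
      - 2 * bumpDensity R ((2 * t) ^ 2 + (2 * v) ^ 2) := by
    intro v
    rw [diffDensity]
    congr 3
    ring
  rw [abel]
  simp only [h4]
  rw [integral_sub (integrable_bumpDensity_line t) (hi.const_mul 2), integral_const_mul, h2,
    mul_inv_cancel_left₀ two_ne_zero]
  rfl

/-- The Abel transform of a radially decreasing density is decreasing in `|t|`. -/
lemma abel_diffDensity_nonneg (t : ℝ) : 0 ≤ abel (diffDensity R) t := by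
  rw [abel_diffDensity, sub_nonneg]
  refine integral_mono (integrable_bumpDensity_line _) (integrable_bumpDensity_line _) fun v => ?_
  exact bumpDensity_anti (by nlinarith [sq_nonneg t])

end Densities

/-! ### Signs of the angle functions -/

/-- The pole `e₃` of the sphere. -/
noncomputable def northPole : S2 := ⟨EuclideanSpace.single 2 1, by simp⟩

/-- The point `e₁` of the equator. -/
noncomputable def equatorPoint : S2 := ⟨EuclideanSpace.single 0 1, by simp⟩

lemma horiz_northPole : horiz (northPole : E3) = 0 := by
  rw [horiz_apply]; apply Complex.ext <;> simp [northPole]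

lemma northPole_two : (northPole : E3) 2 = 1 := by simp [northPole]

lemma horiz_equatorPoint : horiz (equatorPoint : E3) = 1 := by
  rw [horiz_apply]; apply Complex.ext <;> simp [equatorPoint]

lemma equatorPoint_two : (equatorPoint : E3) 2 = 0 := by simp [equatorPoint]

lemma bandProfile_bumpDensity_ne_zero {R : ℝ} (hR : 0 < R) (s : ℝ) :
    bandProfile s (bumpDensity R) ≠ 0 := by
  intro h
  have := congrFun h equatorPoint
  rw [bandProfile, horiz_equatorPoint, equatorPoint_two, norm_one, Real.one_rpow, one_mul,
    zero_div] at this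
  exact (abel_bumpDensity_zero_pos hR).ne' this

lemma bandAngle_bumpDensity_pos {R : ℝ} (hR : 0 < R) {s : ℝ} (h1 : 1 < s) (h3 : s < 3) (ξ : S2) :
    0 < bandAngle s (bumpDensity R) ξ :=
  mul_pos (rieszRatio_pos h1 h3) (bandPotential_pos (isRadialDensity_bumpDensity R) (by linarith)
    (by linarith) bumpDensity_nonneg (fun _ => bumpDensity_pos) hR (ne_zero_of_mem_unit_sphere ξ))

/-- Concentrating the density at the origin by the factor `2` multiplies its integral against
`‖y‖⁻ᵇ` by `2^(b - 2)`, compared with `2⁻²` for its mass. -/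
lemma integral_rpow_mul_diffDensity {R b : ℝ} (hb0 : 0 ≤ b) (hb2 : b < 2) :
    ∫ y : ℂ, ‖y‖ ^ (-b) * diffDensity R (‖y‖ ^ 2) =
      (1 - 2 ^ (b - 1)) * ∫ y : ℂ, ‖y‖ ^ (-b) * bumpDensity R (‖y‖ ^ 2) := by
  have hi := integrable_norm_add_rpow_mul (isRadialDensity_bumpDensity R) hb0 hb2 0
  simp only [zero_add] at hi
  have h1 : ∀ y : ℂ, ‖y‖ ^ (-b) * diffDensity R (‖y‖ ^ 2) = ‖y‖ ^ (-b) * bumpDensity R (‖y‖ ^ 2)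
      - 2 * 2 ^ b * (‖(2 : ℝ) • y‖ ^ (-b) * bumpDensity R (‖(2 : ℝ) • y‖ ^ 2)) := by
    intro y
    have h2 : ‖(2 : ℝ) • y‖ = 2 * ‖y‖ := by rw [norm_smul]; norm_num
    rw [h2, Real.mul_rpow (by norm_num) (norm_nonneg y), Real.rpow_neg (by norm_num : (0 : ℝ) ≤ 2),
      diffDensity, mul_pow]
    have : (2 : ℝ) ^ b ≠ 0 := by positivity
    field_simp
    norm_num
  simp only [h1]
  rw [integral_sub hi ((hi.comp_smul two_ne_zero).const_mul _), integral_const_mul,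
    Measure.integral_comp_smul volume (fun y : ℂ => ‖y‖ ^ (-b) * bumpDensity R (‖y‖ ^ 2)) 2,
    Complex.finrank_real_complex, smul_eq_mul, Real.rpow_sub_one two_ne_zero,
    abs_of_pos (by norm_num)]
  ring

lemma signChanging_bandAngle {R : ℝ} (hR : 0 < R) {s : ℝ} (h1 : 1 < s) (h2 : s < 2) :
    SignChanging (bandAngle s (diffDensity R)) := by
  have hC := rieszRatio_pos h1 (by linarith : s < 3)
  have hpos : ∀ (b : ℝ) (ξ : S2), 0 ≤ b → b < 2 → 0 < bandPotential b (bumpDensity R) (ξ : E3) :=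
    fun b ξ hb0 hb2 => bandPotential_pos (isRadialDensity_bumpDensity R) hb0 hb2 bumpDensity_nonneg
      (fun _ => bumpDensity_pos) hR (ne_zero_of_mem_unit_sphere ξ)
  constructor
  · -- on the equator the potential is the mass of the density
    refine ⟨equatorPoint, mul_pos hC ?_⟩
    have h := integral_rpow_mul_diffDensity (R := R) (b := 0) le_rfl two_pos
    have hp := hpos 0 equatorPoint le_rfl two_pos
    simp only [bandPotential, planeProj, horiz_equatorPoint, equatorPoint_two, zero_smul, add_zero,
      norm_one, Real.one_rpow, one_mul, neg_zero, Real.rpow_zero] at h hp ⊢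
    rw [h]
    refine mul_pos ?_ hp
    rw [zero_sub, Real.rpow_neg_one]
    norm_num
  · refine ⟨northPole, mul_neg_of_pos_of_neg hC ?_⟩
    have h := integral_rpow_mul_diffDensity (R := R) (b := 3 - s) (by linarith) (by linarith)
    have hp := hpos (3 - s) northPole (by linarith) (by linarith)
    simp only [bandPotential, planeProj, horiz_northPole, northPole_two, one_smul, zero_add] at hp ⊢
    rw [h]
    refine mul_neg_of_neg_of_pos ?_ hp
    have := Real.one_lt_rpow (x := 2) (by norm_num) (by linarith : 0 < 3 - s - 1)
    linarith

lemma bandAngleOne_bumpDensity_nonneg (R : ℝ) (ξ : S2) : 0 ≤ bandAngleOne (bumpDensity R) ξ :=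
  div_nonneg (bumpDensity_nonneg _) (sq_nonneg _)

lemma signChanging_bandAngleOne {R : ℝ} (hR : 0 < R) :
    SignChanging (bandAngleOne (diffDensity R)) := by
  have hR2 : 0 < R ^ 2 := by positivity
  constructor
  · -- a direction of slope between the radii of the two discs
    have hne : cyl (((R / 2 : ℝ) : ℂ), 1) ≠ 0 := fun h => by
      simpa using congrArg (fun x : E3 => x 2) h
    refine ⟨direction _ hne, ?_⟩
    have h := homogeneousExt_bandAngleOne (diffDensity R) hne
    rw [homogeneousExt_of_ne hne, horiz_cyl, cyl_apply_two] at h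
    simp only [Complex.norm_real, Real.norm_eq_abs, sq_abs, one_pow, div_one] at h
    rw [diffDensity, (isRadialDensity_bumpDensity R).eq_zero (4 * (R / 2) ^ 2) (by linarith),
      mul_zero, sub_zero] at h
    have h1 : 0 < bumpDensity R ((R / 2) ^ 2) := bumpDensity_pos (by nlinarith)
    rw [← h] at h1
    exact pos_of_mul_pos_right h1 (by positivity)
  · refine ⟨northPole, ?_⟩
    rw [bandAngleOne, horiz_northPole, northPole_two, norm_zero]
    have : 0 < bumpDensity R 0 := bumpDensity_pos hR2
    simp only [diffDensity, one_pow, div_one, ne_eq, two_ne_zero, not_false_eq_true, zero_pow,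
      mul_zero]
    linarith

/-! ### Strict positivity fails for `s = 1` -/

/-- The dilation by `ε` of the vertical axis. -/
noncomputable def stretch (ε : ℝ) (hε : ε ≠ 0) : E3 ≃L[ℝ] E3 :=
  LinearEquiv.toContinuousLinearEquiv
    { toFun := fun x => cyl (horiz x, ε * x 2)
      invFun := fun x => cyl (horiz x, ε⁻¹ * x 2)
      map_add' := fun x y => by
        rw [map_add horiz, PiLp.add_apply, mul_add]
        exact map_add cyl (horiz x, ε * x 2) (horiz y, ε * y 2)
      map_smul' := fun c x => by
        rw [map_smul horiz, PiLp.smul_apply, smul_eq_mul, mul_left_comm]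
        exact map_smul cyl c (horiz x, ε * x 2)
      left_inv := fun x => by
        simp only [horiz_cyl, cyl_apply_two, inv_mul_cancel_left₀ hε, cyl_horiz]
      right_inv := fun x => by
        simp only [horiz_cyl, cyl_apply_two, mul_inv_cancel_left₀ hε, cyl_horiz] }

lemma stretch_apply {ε : ℝ} (hε : ε ≠ 0) (x : E3) : stretch ε hε x = cyl (horiz x, ε * x 2) := rfl

@[simp] lemma horiz_stretch {ε : ℝ} (hε : ε ≠ 0) (x : E3) : horiz (stretch ε hε x) = horiz x := rfl

lemma stretch_symm_stretch {ε : ℝ} (hε : ε ≠ 0) (x : E3) :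
    stretch ε⁻¹ (inv_ne_zero hε) (stretch ε hε x) = x := by
  simp only [stretch_apply, horiz_cyl, cyl_apply_two, inv_mul_cancel_left₀ hε, cyl_horiz]

lemma inner_cyl_cyl (q r : ℂ × ℝ) : ⟪cyl q, cyl r⟫ = ⟪q.1, r.1⟫ + q.2 * r.2 := by
  rw [PiLp.inner_apply, Fin.sum_univ_three, cyl_apply, cyl_apply]
  simp [Complex.inner]
  ring

lemma inner_stretch {ε : ℝ} (hε : ε ≠ 0) (x y : E3) :
    ⟪stretch ε hε x, y⟫ = ⟪x, stretch ε hε y⟫ := by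
  rw [← cyl_horiz x, ← cyl_horiz y]
  simp only [stretch_apply, horiz_cyl, cyl_apply_two, inner_cyl_cyl]
  ring

/-- The value of the Jacobian plays no role below: it appears on both sides of the pairing. -/
lemma exists_integral_comp_equiv (T : E3 ≃L[ℝ] E3) :
    ∃ κ : ℝ, ∀ f : E3 → ℂ, ∫ x, f (T x) = κ * ∫ x, f x := by
  have hdet : LinearMap.det (T.toLinearEquiv : E3 →ₗ[ℝ] E3) ≠ 0 :=
    (LinearEquiv.isUnit_det' T.toLinearEquiv).ne_zero
  refine ⟨|(LinearMap.det (T.toLinearEquiv : E3 →ₗ[ℝ] E3))⁻¹|, fun f => ?_⟩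
  have h := Measure.map_linearMap_addHaar_eq_smul_addHaar (volume : Measure E3) hdet
  have h2 : ∫ x, f (T x) = ∫ x, f x ∂(Measure.map T volume) :=
    (T.toHomeomorph.measurableEmbedding.integral_map f).symm
  rw [h2]
  change ∫ x, f x ∂(Measure.map (T.toLinearEquiv : E3 →ₗ[ℝ] E3) volume) = _
  rw [h, integral_smul_measure, ENNReal.toReal_ofReal (abs_nonneg _), Complex.real_smul]

/-- The Fourier pairing after an anisotropic dilation of the test function. -/
lemma IsFourierAngleFunction.pairing_stretch {s : ℝ} {Ω Ωt : S2 → ℝ} (h : IsFourierAngleFunction s Ω Ωt)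
    (U : 𝓢(E3, ℂ)) {ε : ℝ} (hε : ε ≠ 0) :
    ∫ x : E3, (homogeneousExt (-s) Ω x : ℂ) * (𝓕 U) (stretch ε hε x) =
      ∫ ξ : E3, (homogeneousExt (-3 + s) Ωt (stretch ε hε ξ) : ℂ) * U ξ := by
  set T := stretch ε hε
  set T' := stretch ε⁻¹ (inv_ne_zero hε)
  have hTT' : ∀ x, T' (T x) = x := stretch_symm_stretch hε
  obtain ⟨κ, hκi⟩ := exists_integral_comp_equiv T
  let φ : 𝓢(E3, ℂ) := SchwartzMap.compCLMOfContinuousLinearEquiv ℂ T' U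
  have hφ : ∀ ξ, φ ξ = U (T' ξ) := fun ξ => rfl
  have hF : ∀ x, (𝓕 U) (T x) = (κ : ℂ) * (𝓕 φ) x := by
    intro x
    rw [SchwartzMap.fourier_coe, SchwartzMap.fourier_coe, Real.fourier_eq, Real.fourier_eq, ← hκi]
    congr 1 with ξ
    rw [hφ, hTT', ← inner_stretch]
  have hG := hκi fun ξ => (homogeneousExt (-3 + s) Ωt ξ : ℂ) * φ ξ
  simp only [hφ, hTT'] at hG
  rw [hG]
  simp only [hF, mul_left_comm _ (κ : ℂ)]
  rw [integral_const_mul, h.fourier φ]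
  rfl

/-- A nonnegative smooth function supported in the unit ball. -/
noncomputable def unitBump (ξ : E3) : ℝ := expNegInvGlue (1 - ‖ξ‖ ^ 2)

lemma unitBump_nonneg (ξ : E3) : 0 ≤ unitBump ξ := expNegInvGlue.nonneg _

lemma continuous_unitBump : Continuous unitBump :=
  (expNegInvGlue.contDiff (n := 0)).continuous.comp (f := fun ξ : E3 => 1 - ‖ξ‖ ^ 2) (by fun_prop)

lemma hasCompactSupport_unitBump : HasCompactSupport unitBump :=
  HasCompactSupport.intro (isCompact_closedBall 0 1) fun ξ hξ => by
    refine expNegInvGlue.zero_of_nonpos ?_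
    have : 1 < ‖ξ‖ := by simpa using hξ
    nlinarith

/-- The bump function as a Schwartz function. -/
noncomputable def unitBumpSchwartz : 𝓢(E3, ℂ) :=
  HasCompactSupport.toSchwartzMap (f := fun ξ => (unitBump ξ : ℂ))
    (hasCompactSupport_unitBump.comp_left (g := fun r : ℝ => (r : ℂ)) (by simp))
    (Complex.ofRealCLM.contDiff.comp
      (expNegInvGlue.contDiff.comp (contDiff_const.sub (contDiff_norm_sq ℝ))))

lemma unitBumpSchwartz_apply (ξ : E3) : unitBumpSchwartz ξ = (unitBump ξ : ℂ) := rfl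

/-- The inverse square of the distance to an axis is not locally integrable near the axis. -/
lemma not_integrable_horiz_rpow_mul_unitBump :
    ¬ Integrable fun ξ : E3 => ‖horiz ξ‖ ^ (-2 : ℝ) * unitBump ξ := by
  intro h
  rw [integrable_iff_integrable_cyl, Measure.volume_eq_prod] at h
  simp only [horiz_cyl] at h
  have hpos : (volume : Measure ℝ) (ball 0 (1 / 2)) ≠ 0 := (measure_ball_pos _ _ (by norm_num)).ne'
  obtain ⟨t, ht, hint⟩ := ((frequently_ae_mem_iff.2 hpos).and_eventually h.prod_left_ae).exists
  have ht2 : t ^ 2 < 1 / 4 := by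
    rw [mem_ball_zero_iff, Real.norm_eq_abs] at ht
    rw [← sq_abs]
    nlinarith [abs_nonneg t]
  have hδ : 0 < expNegInvGlue (1 / 2) := expNegInvGlue.pos_of_pos (by norm_num)
  have hon : IntegrableOn (fun z : ℂ => ‖z‖ ^ (-2 : ℝ)) (ball 0 (1 / 2)) := by
    refine (hint.integrableOn.const_mul (expNegInvGlue (1 / 2))⁻¹).mono'
      (Measurable.aestronglyMeasurable (by fun_prop)) ?_
    filter_upwards [ae_restrict_mem measurableSet_ball] with z hz
    rw [mem_ball_zero_iff] at hz
    rw [Real.norm_of_nonneg (by positivity)]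
    have h1 : expNegInvGlue (1 / 2) ≤ unitBump (cyl (z, t)) := by
      apply expNegInvGlue.monotone
      rw [norm_cyl_sq]
      nlinarith [norm_nonneg z]
    rw [mul_left_comm]
    refine le_mul_of_one_le_right (by positivity) ?_
    rw [inv_mul_eq_div, one_le_div hδ]
    exact h1
  rw [integrableOn_fun_norm_addHaar volume (f := fun r : ℝ => r ^ (-2 : ℝ)),
    Complex.finrank_real_complex] at hon
  have h2 : IntegrableOn (fun r : ℝ => r ^ (-1 : ℝ)) (Set.Ioo 0 (1 / 2)) := by
    refine hon.congr_fun (fun r hr => ?_) measurableSet_Ioo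
    have hr0 : 0 < r := hr.1
    simp only [smul_eq_mul]
    rw [← Real.rpow_natCast r (2 - 1), ← Real.rpow_add hr0]
    norm_num
  rw [intervalIntegral.integrableOn_Ioo_rpow_iff (by norm_num)] at h2
  exact lt_irrefl _ h2

lemma norm_stretch_sq {ε : ℝ} (hε : ε ≠ 0) (ξ : E3) :
    ‖stretch ε hε ξ‖ ^ 2 = ‖horiz ξ‖ ^ 2 + (ε * ξ 2) ^ 2 := by
  rw [stretch_apply, norm_cyl_sq]

lemma integrable_stretch_rpow_mul_unitBump {ε : ℝ} (hε : 0 < ε) (h1 : ε ≤ 1) :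
    Integrable fun ξ : E3 => ‖stretch ε hε.ne' ξ‖ ^ (-2 : ℝ) * unitBump ξ := by
  obtain ⟨C, hC⟩ := hasCompactSupport_unitBump.exists_bound_of_continuous continuous_unitBump
  have h3 : Module.finrank ℝ E3 = 3 := by simp
  have h := (integrable_norm_rpow_mul (E := E3) volume (b := 2) (by norm_num)
    (by rw [h3]; norm_num)
    (continuous_unitBump.integrable_of_hasCompactSupport hasCompactSupport_unitBump) hC).const_mul
      (ε ^ (-2 : ℝ))
  refine h.mono' ?_ ?_
  · have : Measurable fun ξ : E3 => ‖stretch ε hε.ne' ξ‖ ^ (-2 : ℝ) :=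
      ((stretch ε hε.ne').continuous.norm.measurable).pow_const _
    exact this.aestronglyMeasurable.mul continuous_unitBump.aestronglyMeasurable
  · filter_upwards with ξ
    rw [Real.norm_of_nonneg (mul_nonneg (by positivity) (unitBump_nonneg ξ)), ← mul_assoc]
    refine mul_le_mul_of_nonneg_right ?_ (unitBump_nonneg ξ)
    by_cases hξ : ξ = 0
    · simp [hξ]
    · have hξ' : 0 < ‖ξ‖ := norm_pos_iff.2 hξ
      rw [← Real.mul_rpow hε.le (norm_nonneg ξ)]
      refine Real.rpow_le_rpow_of_nonpos (by positivity) ?_ (by norm_num)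
      refine le_of_sq_le_sq ?_ (norm_nonneg _)
      rw [norm_stretch_sq, mul_pow, norm_sq_eq ξ]
      nlinarith [sq_nonneg ‖horiz ξ‖, mul_le_one₀ h1 hε.le h1]

/-- Fatou's lemma along vertical dilations: the integrals of `‖(ξ₁, ξ₂, ε ξ₃)‖⁻²` against a bump
function are unbounded as `ε → 0`. -/
lemma exists_lt_integral_stretch (B : ℝ) :
    ∃ ε : ℝ, ∃ hε : 0 < ε, ε ≤ 1 ∧ B < ∫ ξ : E3, ‖stretch ε hε.ne' ξ‖ ^ (-2 : ℝ) * unitBump ξ := by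
  by_contra! hB
  apply not_integrable_horiz_rpow_mul_unitBump
  have hpos : ∀ n : ℕ, 0 < 1 / ((n : ℝ) + 1) := fun n => Nat.one_div_pos_of_nat
  have hle : ∀ n : ℕ, 1 / ((n : ℝ) + 1) ≤ 1 := fun n => by
    rw [div_le_one (by positivity)]; linarith [(Nat.cast_nonneg n : (0 : ℝ) ≤ n)]
  set f : ℕ → E3 → ℝ := fun n ξ => ‖stretch _ (hpos n).ne' ξ‖ ^ (-2 : ℝ) * unitBump ξ with hf
  have hf0 : ∀ n ξ, 0 ≤ f n ξ := fun n ξ => mul_nonneg (by positivity) (unitBump_nonneg ξ)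
  have hfi : ∀ n, Integrable (f n) := fun n => integrable_stretch_rpow_mul_unitBump (hpos n) (hle n)
  refine ⟨?_, ?_⟩
  · exact (Measurable.pow_const horiz.continuous.norm.measurable _).aestronglyMeasurable.mul
      continuous_unitBump.aestronglyMeasurable
  · rw [hasFiniteIntegral_iff_ofReal (Filter.Eventually.of_forall fun ξ =>
      mul_nonneg (by positivity) (unitBump_nonneg ξ))]
    have hpt : ∀ ξ : E3, ENNReal.ofReal (‖horiz ξ‖ ^ (-2 : ℝ) * unitBump ξ) ≤
        Filter.liminf (fun n => ENNReal.ofReal (f n ξ)) Filter.atTop := by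
      intro ξ
      by_cases hξ : ‖horiz ξ‖ = 0
      · -- on the axis the left-hand side takes the junk value `0 ^ (-2) = 0`
        rw [hξ, Real.zero_rpow (by norm_num), zero_mul, ENNReal.ofReal_zero]
        exact zero_le
      · refine (Filter.Tendsto.liminf_eq (ENNReal.tendsto_ofReal ?_)).ge
        refine Filter.Tendsto.mul_const _ (Filter.Tendsto.rpow_const ?_ (Or.inl hξ))
        have h1 : ∀ n : ℕ, ‖stretch _ (hpos n).ne' ξ‖ =
            Real.sqrt (‖horiz ξ‖ ^ 2 + (1 / ((n : ℝ) + 1) * ξ 2) ^ 2) := by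
          intro n
          rw [← norm_stretch_sq (hpos n).ne', Real.sqrt_sq (norm_nonneg _)]
        simp only [h1]
        have h2 : Filter.Tendsto (fun n : ℕ => ‖horiz ξ‖ ^ 2 + (1 / ((n : ℝ) + 1) * ξ 2) ^ 2)
            Filter.atTop (nhds (‖horiz ξ‖ ^ 2 + (0 * ξ 2) ^ 2)) :=
          ((tendsto_one_div_add_atTop_nhds_zero_nat.mul_const _).pow 2).const_add _
        have h3 := (Real.continuous_sqrt.tendsto _).comp h2
        rwa [zero_mul, zero_pow two_ne_zero, add_zero, Real.sqrt_sq (norm_nonneg _)] at h3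
    calc ∫⁻ ξ, ENNReal.ofReal (‖horiz ξ‖ ^ (-2 : ℝ) * unitBump ξ)
        ≤ ∫⁻ ξ, Filter.liminf (fun n => ENNReal.ofReal (f n ξ)) Filter.atTop := lintegral_mono hpt
      _ ≤ Filter.liminf (fun n => ∫⁻ ξ, ENNReal.ofReal (f n ξ)) Filter.atTop := by
          refine lintegral_liminf_le fun n => ?_
          refine Measurable.ennreal_ofReal (Measurable.mul ?_ continuous_unitBump.measurable)
          exact ((stretch _ (hpos n).ne').continuous.norm.measurable).pow_const _
      _ ≤ Filter.liminf (fun _ : ℕ => ENNReal.ofReal B) Filter.atTop := by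
          refine Filter.liminf_le_liminf (Filter.Eventually.of_forall fun n => ?_)
          change ∫⁻ ξ, ENNReal.ofReal (f n ξ) ≤ ENNReal.ofReal B
          rw [← ofReal_integral_eq_lintegral_ofReal (hfi n) (Filter.Eventually.of_forall (hf0 n))]
          exact ENNReal.ofReal_le_ofReal (hB _ (hpos n) (hle n))
      _ = ENNReal.ofReal B := Filter.liminf_const _
      _ < ⊤ := ENNReal.ofReal_lt_top

/-- The homogeneous extension of an even function that vanishes on the polar cap is supported in a
cone around the horizontal plane. -/
lemma cos_mul_norm_le_norm_horiz {θ₀ : ℝ} (h0 : 0 < θ₀) (h1 : θ₀ < Real.pi / 2) {Ω : S2 → ℝ}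
    (heven : ∀ x : S2, Ω (-x) = Ω x)
    (hΩ : ∀ x, polarAngle x ≤ Real.pi / 2 - θ₀ → Ω x = 0) {p : ℝ} {x : E3}
    (hx : homogeneousExt p Ω x ≠ 0) : Real.cos θ₀ * ‖x‖ ≤ ‖horiz x‖ := by
  have hx0 : x ≠ 0 := fun h => hx (by simp [homogeneousExt, h])
  have hx' : 0 < ‖x‖ := norm_pos_iff.2 hx0
  have hsin : 0 < Real.sin θ₀ := Real.sin_pos_of_pos_of_lt_pi h0 (by linarith)
  have hcos : 0 < Real.cos θ₀ := Real.cos_pos_of_mem_Ioo ⟨by linarith, h1⟩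
  have hcap : ∀ σ : S2, Real.sin θ₀ ≤ (σ : E3) 2 → Ω σ = 0 := by
    intro σ hσ
    apply hΩ
    rw [polarAngle, ← Real.arccos_cos (x := Real.pi / 2 - θ₀) (by linarith) (by linarith),
      Real.cos_pi_div_two_sub]
    exact Real.antitone_arccos hσ
  rw [homogeneousExt_of_ne hx0] at hx
  have hΩx : Ω (direction x hx0) ≠ 0 := right_ne_zero_of_mul hx
  have hlt : |(direction x hx0 : E3) 2| < Real.sin θ₀ := by
    rw [abs_lt]
    constructor
    · by_contra! h
      apply hΩx
      rw [← heven]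
      refine hcap _ ?_
      have : ((-direction x hx0 : S2) : E3) = -(direction x hx0 : E3) := rfl
      rw [this, PiLp.neg_apply]
      linarith
    · by_contra! h
      exact hΩx (hcap _ h)
  have hs := sphere_norm_sq (direction x hx0)
  rw [horiz_direction, norm_smul, norm_inv, norm_norm] at hs
  have hsq : (direction x hx0 : E3) 2 ^ 2 ≤ Real.sin θ₀ ^ 2 := by
    rw [← sq_abs]
    gcongr
  have h2 := Real.sin_sq_add_cos_sq θ₀
  have h3 : Real.cos θ₀ ≤ ‖x‖⁻¹ * ‖horiz x‖ := by
    refine le_of_sq_le_sq ?_ (by positivity)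
    linarith
  rwa [inv_mul_eq_div, le_div_iff₀ hx'] at h3

/-- For `s = 1` no even profile that vanishes near the poles has a strictly positive angle function.
Against test functions concentrated on the horizontal plane, one side of the Fourier identity stays
bounded, since the profile is supported away from the vertical axis, while the other one would
contain `∫ ‖η‖⁻²` over a neighbourhood of `0` in the plane. -/
theorem IsFourierAngleFunction.not_pos_of_vanishing {θ₀ : ℝ} (h0 : 0 < θ₀) (h1 : θ₀ < Real.pi / 2)
    {Ω Ωt : S2 → ℝ} (hcont : Continuous Ω) (heven : ∀ x : S2, Ω (-x) = Ω x)
    (hΩ : ∀ x, polarAngle x ≤ Real.pi / 2 - θ₀ → Ω x = 0) (hF : IsFourierAngleFunction 1 Ω Ωt) :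
    ¬ ∀ ξ, 0 < Ωt ξ := by
  intro hpos
  have hcos : 0 < Real.cos θ₀ := Real.cos_pos_of_mem_Ioo ⟨by linarith, h1⟩
  have hcos1 : Real.cos θ₀ ≤ 1 := Real.cos_le_one _
  have : Nonempty S2 := ⟨northPole⟩
  obtain ⟨ξ₀, -, hmin⟩ := isCompact_univ.exists_isMinOn (Set.univ_nonempty) hF.continuous.continuousOn
  set c := Ωt ξ₀
  have hc0 : 0 < c := hpos ξ₀
  have hlower : ∀ ξ : E3, ξ ≠ 0 → c * ‖ξ‖ ^ (-2 : ℝ) ≤ homogeneousExt (-2) Ωt ξ := by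
    intro ξ hξ
    rw [homogeneousExt_of_ne hξ, mul_comm]
    exact mul_le_mul_of_nonneg_left (hmin (Set.mem_univ _)) (by positivity)
  obtain ⟨M, hM0, hM⟩ := exists_abs_homogeneousExt_le hcont
  obtain ⟨C, hC0, hC⟩ := (𝓕 unitBumpSchwartz).exists_decay_cyl 4 0
  have h3 : Module.finrank ℝ E3 = 3 := by simp
  have hdom : Integrable fun x : E3 => M * C * (Real.cos θ₀ ^ 4)⁻¹ *
      (‖x‖ ^ (-1 : ℝ) * ((1 + ‖x‖) ^ 4)⁻¹) := by
    refine Integrable.const_mul (integrable_norm_rpow_mul volume (by norm_num)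
      (by rw [h3]; norm_num) (integrable_inv_one_add_norm_pow volume (by rw [h3]; norm_num))
      (C := 1) fun x => ?_) _
    rw [abs_of_nonneg (by positivity)]
    exact inv_one_add_norm_pow_le_one x 4
  obtain ⟨ε, hε, hε1, hlt⟩ := exists_lt_integral_stretch
    (c⁻¹ * ∫ x : E3, M * C * (Real.cos θ₀ ^ 4)⁻¹ * (‖x‖ ^ (-1 : ℝ) * ((1 + ‖x‖) ^ 4)⁻¹))
  have hid := hF.pairing_stretch unitBumpSchwartz hε.ne'
  have hexp : (-3 + 1 : ℝ) = -2 := by norm_num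
  rw [hexp] at hid
  -- the side of `Ω` is bounded independently of `ε`
  have hupper : ‖∫ x : E3, (homogeneousExt (-1) Ω x : ℂ) *
      (𝓕 unitBumpSchwartz) (stretch ε hε.ne' x)‖ ≤
      ∫ x : E3, M * C * (Real.cos θ₀ ^ 4)⁻¹ * (‖x‖ ^ (-1 : ℝ) * ((1 + ‖x‖) ^ 4)⁻¹) := by
    refine norm_integral_le_of_norm_le hdom (Filter.Eventually.of_forall fun x => ?_)
    by_cases hx : homogeneousExt (-1) Ω x = 0
    · rw [hx, Complex.ofReal_zero, zero_mul, norm_zero]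
      positivity
    · have hcone := cos_mul_norm_le_norm_horiz h0 h1 heven hΩ hx
      have hb := hC (horiz x, ε * x 2)
      rw [pow_zero, inv_one, mul_one] at hb
      have hc4 : (Real.cos θ₀ * (1 + ‖x‖)) ^ 4 ≤ (1 + ‖horiz x‖) ^ 4 := by
        gcongr
        linarith
      have hinv : ((1 + ‖horiz x‖) ^ 4)⁻¹ ≤ (Real.cos θ₀ ^ 4)⁻¹ * ((1 + ‖x‖) ^ 4)⁻¹ := by
        rw [← mul_inv, ← mul_pow]
        exact inv_anti₀ (by positivity) hc4
      rw [norm_mul, Complex.norm_real, Real.norm_eq_abs, stretch_apply]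
      calc |homogeneousExt (-1) Ω x| * ‖(𝓕 unitBumpSchwartz) (cyl (horiz x, ε * x 2))‖
          ≤ (M * ‖x‖ ^ (-1 : ℝ)) * (C * ((Real.cos θ₀ ^ 4)⁻¹ * ((1 + ‖x‖) ^ 4)⁻¹)) := by
            refine mul_le_mul (hM _ x) (hb.trans ?_) (norm_nonneg _) (by positivity)
            gcongr
        _ = _ := by ring
  rw [hid] at hupper
  obtain ⟨M', -, hM'⟩ := exists_abs_homogeneousExt_le hF.continuous
  have hf := integrable_stretch_rpow_mul_unitBump hε hε1
  have hGi : Integrable fun ξ : E3 =>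
      homogeneousExt (-2) Ωt (stretch ε hε.ne' ξ) * unitBump ξ := by
    refine (hf.const_mul M').mono' ?_ (Filter.Eventually.of_forall fun ξ => ?_)
    · exact ((measurable_homogeneousExt hF.continuous _).comp
        (stretch ε hε.ne').continuous.measurable).aestronglyMeasurable.mul
        continuous_unitBump.aestronglyMeasurable
    · rw [norm_mul, Real.norm_eq_abs, Real.norm_of_nonneg (unitBump_nonneg ξ), ← mul_assoc]
      exact mul_le_mul_of_nonneg_right (hM' _ _) (unitBump_nonneg ξ)
  have hreal : ∫ ξ : E3, (homogeneousExt (-2) Ωt (stretch ε hε.ne' ξ) : ℂ) *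
      unitBumpSchwartz ξ =
      ((∫ ξ : E3, homogeneousExt (-2) Ωt (stretch ε hε.ne' ξ) * unitBump ξ : ℝ) : ℂ) := by
    refine Eq.trans ?_ integral_ofReal
    congr 1 with ξ
    rw [unitBumpSchwartz_apply, ← Complex.ofReal_mul]
    rfl
  rw [hreal, Complex.norm_real] at hupper
  have hge : c * ∫ ξ : E3, ‖stretch ε hε.ne' ξ‖ ^ (-2 : ℝ) * unitBump ξ ≤
      ∫ ξ : E3, homogeneousExt (-2) Ωt (stretch ε hε.ne' ξ) * unitBump ξ := by
    rw [← integral_const_mul]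
    refine integral_mono_ae (hf.const_mul c) hGi ?_
    filter_upwards [ae_ne_zero_E3] with ξ hξ
    rw [← mul_assoc]
    refine mul_le_mul_of_nonneg_right (hlower _ ?_) (unitBump_nonneg ξ)
    exact fun h => hξ ((stretch ε hε.ne').map_eq_zero_iff.1 h)
  rw [inv_mul_eq_div, div_lt_iff₀' hc0] at hlt
  exact absurd (hlt.trans_le (hge.trans ((le_abs_self _).trans hupper))) (lt_irrefl _)

end

theorem theorem5p1 (θ₀ : ℝ) (hθ₀ : 0 < θ₀) (hθ₀' : θ₀ < Real.pi / 2) :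
    (∀ s : ℝ, 1 < s → s < 2 →
      (∃ ω ωt : S2 → ℝ, IsAxisymmetricProfile ω ∧
        (∀ x, polarAngle x ≤ Real.pi / 2 - θ₀ → ω x = 0) ∧
        IsFourierAngleFunction s ω ωt ∧ ∀ ξ, 0 < ωt ξ) ∧
      (∃ ω ωt : S2 → ℝ, IsAxisymmetricProfile ω ∧
        (∀ x, polarAngle x ≤ Real.pi / 2 - θ₀ → ω x = 0) ∧
        IsFourierAngleFunction s ω ωt ∧ SignChanging ωt)) ∧
    (∃ ω ωt : S2 → ℝ, IsAxisymmetricProfile ω ∧ ω ≠ 0 ∧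
      (∀ x, polarAngle x ≤ Real.pi / 2 - θ₀ → ω x = 0) ∧
      IsFourierAngleFunction 1 ω ωt ∧ ∀ ξ, 0 ≤ ωt ξ) ∧
    (∃ ω ωt : S2 → ℝ, IsAxisymmetricProfile ω ∧
      (∀ x, polarAngle x ≤ Real.pi / 2 - θ₀ → ω x = 0) ∧
      IsFourierAngleFunction 1 ω ωt ∧ SignChanging ωt) ∧
    ¬ (∃ ω ωt : S2 → ℝ, IsAxisymmetricProfile ω ∧
      (∀ x, polarAngle x ≤ Real.pi / 2 - θ₀ → ω x = 0) ∧
      IsFourierAngleFunction 1 ω ωt ∧ ∀ ξ, 0 < ωt ξ) := by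
  have hR : 0 < Real.tan θ₀ := Real.tan_pos_of_pos_of_lt_pi_div_two hθ₀ hθ₀'
  have hb := isRadialDensity_bumpDensity (Real.tan θ₀)
  have hd := isRadialDensity_diffDensity (Real.tan θ₀)
  refine ⟨fun s h1 h2 => ⟨?_, ?_⟩, ?_, ?_, ?_⟩
  · exact ⟨_, _, hb.isAxisymmetricProfile_bandProfile (by linarith) abel_bumpDensity_nonneg,
      fun x hx => hb.bandProfile_eq_zero_of_polarAngle hθ₀ hθ₀' (by linarith) hx,
      isFourierAngleFunction_bandAngle hb h1 (by linarith),
      bandAngle_bumpDensity_pos hR h1 (by linarith)⟩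
  · exact ⟨_, _, hd.isAxisymmetricProfile_bandProfile (by linarith) abel_diffDensity_nonneg,
      fun x hx => hd.bandProfile_eq_zero_of_polarAngle hθ₀ hθ₀' (by linarith) hx,
      isFourierAngleFunction_bandAngle hd h1 (by linarith), signChanging_bandAngle hR h1 h2⟩
  · exact ⟨_, _, hb.isAxisymmetricProfile_bandProfile one_ne_zero abel_bumpDensity_nonneg,
      bandProfile_bumpDensity_ne_zero hR 1,
      fun x hx => hb.bandProfile_eq_zero_of_polarAngle hθ₀ hθ₀' one_ne_zero hx,
      isFourierAngleFunction_bandAngleOne hb, bandAngleOne_bumpDensity_nonneg _⟩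
  · exact ⟨_, _, hd.isAxisymmetricProfile_bandProfile one_ne_zero abel_diffDensity_nonneg,
      fun x hx => hd.bandProfile_eq_zero_of_polarAngle hθ₀ hθ₀' one_ne_zero hx,
      isFourierAngleFunction_bandAngleOne hd, signChanging_bandAngleOne hR⟩
  · rintro ⟨ω, ωt, hω, hzero, hF, hpos⟩
    exact hF.not_pos_of_vanishing hθ₀ hθ₀' hω.smooth.continuous hω.even hzero hpos
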